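/- Let $\mathbb K$ be a field. For an integer $n>1$ let $\mathcal P_n=\{1,\dots,n\}^2$ with the product order, and let $\mathrm{rep}\,\mathcal P_n$ be the category of (pointwise) finite-dimensional $\mathbb K$-linear representations of $\mathcal P_n$. A *spread* is a nonempty convex connected subset $\mathcal S$ of $\mathcal P_n$, and $\mathbb I_{\mathcal S}$ denotes its indicator representation (value $\mathbb K$ on $\mathcal S$ and $0$ elsewhere, with identity maps between points of $\mathcal S$). A spread is *single-source* if it has the form $\{c: x\le c\}$, or the form $\{c: x\le c,\ b\not\le c\ \text{for all } b\in D\}$ for a finite antichain $D$ containing some $b\geq x$. Let $\mathcal X$ be either the set of all spread modules, or the set of all single-source spread modules (one per spread), and put $G=\bigoplus_{X\in\mathcal X}X$ and $\Gamma=\mathrm{End}(G)$, acting from the left on $\mathrm{Hom}(M,G)$ by composition. An $\mathrm{add}(\mathcal X)$-*cover* of $M$ is an epimorphism $f:U\to M$ with $U\in\mathrm{add}(\mathcal X)$ such that $\mathrm{Hom}(X,f)$ is surjective for all $X\in\mathcal X$ and every endomorphism $g$ of $U$ with $f g=f$ is an automorphism. A *minimal $\mathrm{add}(\mathcal X)$-resolution*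 of $M$ is an exact sequence $\cdots\to U_1\to U_0\to M\to 0$ in which each $U_{i+1}\to U_i$ and $U_0\to M$ is an $\mathrm{add}(\mathcal X)$-cover of its image; then $\dim_{\mathcal X}(M)=\min(\{j: U_{j+1}=0\}\cup\{\infty\})$, and $\dim_{\mathcal X}(\mathbb K_{\mathcal P_n})=\sup_{M\in\mathrm{rep}\,\mathcal P_n}\dim_{\mathcal X}(M)$. Put $x_i=(i,n+1-i)$ for $1\le i\le n$, $B=\{x_1,\dots,x_n\}$ and $\mathcal S=\{c\in\mathcal P_n: c\le x_i\text{ for some }i\}$. For $p\ge 0$ let $U^p=\bigoplus_{B'\subseteq B,\ |B'|=p}\mathbb I_{\mathcal S\setminus B'}$. For $B'=\{x_{i_1},\dots,x_{i_p}\}$ with $i_1<\dots<i_p$, let the component of the differential $U^{p-1}\to U^{p}$ from $\mathbb I_{(\mathcal S\setminus B')\cup\{x_{i_j}\}}$ to $\mathbb I_{\mathcal S\setminus B'}$ be $(-1)^{j+1}$ times the canonical surjection, all other components being zero. Then, for every $n>1$ and either choice of $\mathcal X$: 1. each $\mathcal S\setminus B'$ ($B'\subseteq B$) is a single-source spread,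 and $G$ is a generator-cogenerator of $\mathrm{rep}\,\mathcal P_n$, i.e. every projective and every injective object of $\mathrm{rep}\,\mathcal P_n$ lies in $\mathrm{add}(\mathcal X)$; 2. $U^\bullet$ is an exact cochain complex; 3. the top of the left $\Gamma$-module $\mathrm{Hom}(\mathbb I_{\mathcal S},G)$, that is, its quotient by its radical, is simple; the complex $\mathrm{Hom}(U^\bullet,G)$ is a minimal projective resolution of this simple module, of length exactly $n$; and this simple module has projective dimension $n$; 4. $\dim_{\mathcal X}(\mathbb K_{\mathcal P_n})\ge n-2$. Consequently, for either choice of $\mathcal X$, there is no $N\in\mathbb N$ with $\dim_{\mathcal X}(\mathbb K_{\mathcal P_n})\le N$ for all $n>1$. -/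

import Mathlib

open CategoryTheory CategoryTheory.Limits

noncomputable section

namespace SpreadRes

universe v u

attribute [local instance] Abelian.hasFiniteBiproducts

/-! ### Spreads in a poset -/

section Spreads

variable {P : Type} [PartialOrder P]

/-- The subset `⟨A, ∞⟨`. -/
def upRegion (A : Set P) : Set P := {c | ∃ a ∈ A, a ≤ c}

/-- The subset `⟨A, B⟩`. -/
def segRegion (A B : Set P) : Set P := {c | (∃ a ∈ A, a ≤ c) ∧ ∃ b ∈ B, c ≤ b}

/-- The subset `⟨A, B⟨`. -/
def hookRegion (A B : Set P) : Set P := {c | (∃ a ∈ A, a ≤ c) ∧ ¬ ∃ b ∈ B, b ≤ c}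

/-- Any two points of `S` are joined by a zigzag of comparable points of `S`. -/
def ZigzagConnected (S : Set P) : Prop :=
  ∀ x ∈ S, ∀ y ∈ S,
    Relation.ReflTransGen (fun a b => a ∈ S ∧ b ∈ S ∧ (a ≤ b ∨ b ≤ a)) x y

variable (P) in
/-- A spread: a nonempty, convex and connected subset. -/
@[ext]
structure Spread where
  carrier : Set P
  nonempty : carrier.Nonempty
  convex : carrier.OrdConnected
  connected : ZigzagConnected carrier

/-- A single-source spread: a spread of the form `⟨x, ∞⟨`, or of the form `⟨x, B⟨` for a finite
antichain `B` with `x ≤ B`. -/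
def Spread.IsSingleSource (S : Spread P) : Prop :=
  ∃ x : P, S.carrier = upRegion {x} ∨
    ∃ B : Set P, B.Finite ∧ IsAntichain (· ≤ ·) B ∧ (∃ b ∈ B, x ≤ b) ∧
      S.carrier = hookRegion {x} B

instance [Finite P] : Finite (Spread P) :=
  Finite.of_injective Spread.carrier (fun _ _ h => Spread.ext h)

end Spreads

/-- The two classes of spreads under consideration. -/
inductive SpreadClass where
  | all
  | singleSource

/-- The set of spreads of a poset that belong to the given class. -/
def SpreadClass.spreads (k : SpreadClass) (P : Type) [PartialOrder P] : Set (Spread P) :=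
  match k with
  | .all => Set.univ
  | .singleSource => {S | S.IsSingleSource}

/-! ### Persistence modules and spread modules -/

/-- The category of representations of `P` over `K`. -/
abbrev PersMod (K : Type u) [Field K] (P : Type) [PartialOrder P] := P ⥤ ModuleCat.{u} K

section Modules

variable (K : Type u) [Field K]

variable {P : Type}

/-- The subspace of `K` which is `K` if `x ∈ S` and `0` otherwise. -/
def fiber (S : Set P) (x : P) : Submodule K K where
  carrier := {c | x ∉ S → c = 0}
  add_mem' ha hb hx := by rw [ha hx, hb hx, add_zero]
  zero_mem' _ := rfl
  smul_mem' r c hc hx := by rw [hc hx, smul_zero]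

open Classical in
/-- The map from the fiber of `S` at `x` to the fiber of `T` at `y` which is the identity of `K`
if `x ∈ S` and `y ∈ T`, and which is zero otherwise. -/
def fiberMap (S T : Set P) (x y : P) : fiber K S x →ₗ[K] fiber K T y where
  toFun c := ⟨if y ∈ T then c.1 else 0, fun hy => if_neg hy⟩
  map_add' a b := by ext; by_cases h : y ∈ T <;> simp [h]
  map_smul' r a := by ext; by_cases h : y ∈ T <;> simp [h]

open Classical in
lemma fiberMap_id (S : Set P) (x : P) : fiberMap K S S x x = LinearMap.id := by
  ext c
  change (if x ∈ S then (c : K) else 0) = c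
  split_ifs with h
  · rfl
  · exact (c.2 h).symm

open Classical in
lemma fiberMap_comp {S T U : Set P} {x y z : P} (h : x ∈ S → z ∈ U → y ∈ T) :
    fiberMap K T U y z ∘ₗ fiberMap K S T x y = fiberMap K S U x z := by
  ext c
  change (if z ∈ U then (if y ∈ T then (c : K) else 0) else 0) = if z ∈ U then (c : K) else 0
  split_ifs with hz hy
  · rfl
  · exact (c.2 fun hx => hy (h hx hz)).symm
  · rfl

variable [PartialOrder P]

variable (P) in
/-- Pointwise finite-dimensional representations. For a finite poset these are exactly the
finitely presentable ones, that is, the objects of `rep P`. -/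
def pwfd : ObjectProperty (PersMod K P) := fun M => ∀ x, FiniteDimensional K (M.obj x)

/-- The spread module of `S`. -/
def spreadModule (S : Spread P) : PersMod K P where
  obj x := ModuleCat.of K (fiber K S.carrier x)
  map {x y} _ := ModuleCat.ofHom (fiberMap K S.carrier S.carrier x y)
  map_id x := ModuleCat.hom_ext (fiberMap_id K S.carrier x)
  map_comp f g := ModuleCat.hom_ext
    (fiberMap_comp K fun hx hz => S.convex.out hx hz ⟨leOfHom f, leOfHom g⟩).symm

/-- `T` is contained in `S` and closed under going down inside `S`. -/
def IsQuotientOf (S T : Spread P) : Prop :=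
  T.carrier ⊆ S.carrier ∧ ∀ x ∈ S.carrier, ∀ y ∈ T.carrier, x ≤ y → x ∈ T.carrier

/-- The canonical quotient map from the spread module of `S` to that of `T`: it is the identity
of `K` at each point of `T`, and zero elsewhere. -/
def quotMap (S T : Spread P) (h : IsQuotientOf S T) : spreadModule K S ⟶ spreadModule K T where
  app x := ModuleCat.ofHom (fiberMap K S.carrier T.carrier x x)
  naturality _ _ f := ModuleCat.hom_ext
    ((fiberMap_comp K fun _ hy => h.1 hy).trans
      (fiberMap_comp K fun hx hy => h.2 _ hx _ hy (leOfHom f)).symm)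

lemma quotMap_comp (S T U : Spread P) (h : IsQuotientOf S T) (h' : IsQuotientOf T U)
    (h'' : IsQuotientOf S U) :
    quotMap K S T h ≫ quotMap K T U h' = quotMap K S U h'' := by
  ext x : 2
  exact ModuleCat.hom_ext (fiberMap_comp K fun _ hx => h'.1 hx)

/-- The set `𝒳` of spread modules of a set of spreads, closed under isomorphism. -/
def modulesOf (F : Set (Spread P)) : ObjectProperty (PersMod K P) :=
  fun M => ∃ S ∈ F, Nonempty (M ≅ spreadModule K S)

/-- The direct sum `G` of the spread modules of a set of spreads. -/
def sumOf [Finite P] (F : Set (Spread P)) : PersMod K P :=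
  ⨁ fun S : F => spreadModule K S.1

end Modules

/-! ### Relative homological algebra -/

section Relative

variable {C : Type u} [Category.{v} C] [Abelian C]

/-- `add 𝒳`: direct summands (in an abelian category: retracts) of finite direct sums of objects
in `𝒳`. -/
def addOf (𝒳 : ObjectProperty C) : ObjectProperty C :=
  fun U => ∃ (m : ℕ) (X : Fin m → C), (∀ i, 𝒳 (X i)) ∧ Nonempty (Retract U (⨁ X))

/-- Epimorphisms `f : A ⟶ B` for which `Hom(X, f)` is surjective for all `X` in `𝒳`; in other
words, epimorphisms that are admissible for the exact structure `F_𝒳`. -/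
def IsAdmissibleEpi (𝒳 : ObjectProperty C) {A B : C} (f : A ⟶ B) : Prop :=
  Epi f ∧ ∀ X, 𝒳 X → ∀ h : X ⟶ B, ∃ g : X ⟶ A, g ≫ f = h

/-- `f : U ⟶ M` is an `add 𝒳`-cover: an admissible epimorphism from an object of `add 𝒳`, such
that each endomorphism `g` of `U` with `f ∘ g = f` is an automorphism. -/
structure IsCover (𝒳 : ObjectProperty C) {U M : C} (f : U ⟶ M) : Prop where
  mem : addOf 𝒳 U
  admissible : IsAdmissibleEpi 𝒳 f
  minimal : ∀ g : U ⟶ U, g ≫ f = f → IsIso g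

/-- The complex `⋯ ⟶ U₁ ⟶ U₀` together with `π : U₀ ⟶ M` is a minimal `add 𝒳`-resolution
of `M`: the sequence `⋯ ⟶ U₁ ⟶ U₀ ⟶ M ⟶ 0` is exact, and `π` and the differentials are
`add 𝒳`-covers of their images. (In particular the sequence is `F_𝒳`-exact.) -/
structure IsMinimalResolution (𝒳 : ObjectProperty C) {M : C} (U : ChainComplex C ℕ)
    (π : U.X 0 ⟶ M) : Prop where
  w : U.d 1 0 ≫ π = 0
  exact_zero : (ShortComplex.mk (U.d 1 0) π w).Exact
  exact_succ : ∀ i, U.ExactAt (i + 1)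
  cover_zero : IsCover 𝒳 π
  cover_succ : ∀ i, IsCover 𝒳 (Abelian.factorThruImage (U.d (i + 1) i))

/-- `min ({j | U_{j+1} = 0} ∪ {∞})`. -/
def resolutionLength (U : ChainComplex C ℕ) : ℕ∞ :=
  ⨅ (j : ℕ) (_ : IsZero (U.X (j + 1))), (j : ℕ∞)

/-- The `add 𝒳`-dimension of `M`: the length of a minimal `add 𝒳`-resolution of `M`. Such a
resolution is unique up to isomorphism, so the supremum is over a single value. -/
def relDim (𝒳 : ObjectProperty C) (M : C) : ℕ∞ :=
  ⨆ (U : ChainComplex C ℕ) (π : U.X 0 ⟶ M) (_ : IsMinimalResolution 𝒳 U π), resolutionLength U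

/-- The supremum of the `add 𝒳`-dimensions of the objects satisfying `𝒜`. -/
def relGlobalDim (𝒜 𝒳 : ObjectProperty C) : ℕ∞ :=
  ⨆ (M : C) (_ : 𝒜 M), relDim 𝒳 M

/-- The left `End G`-module `Hom(X, G)`, on which endomorphisms of `G` act by composition. -/
abbrev homModule (X G : C) : ModuleCat.{v} (End G) := ModuleCat.of (End G) (X ⟶ G)

/-- The top of the left `End G`-module `Hom(X, G)`, its quotient by its (Jacobson) radical. -/
abbrev topHomModule (X G : C) : ModuleCat.{v} (End G) :=
  ModuleCat.of (End G) ((X ⟶ G) ⧸ Module.jacobson (End G) (X ⟶ G))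

/-- The chain complex of `End G`-modules obtained by applying `Hom(-, G)` to a cochain complex. -/
def homComplex (U : CochainComplex C ℕ) (G : C) : ChainComplex (ModuleCat.{v} (End G)) ℕ :=
  ((preadditiveYonedaObj G).mapHomologicalComplex (ComplexShape.down ℕ)).obj U.op

end Relative

/-- The `add 𝒳`-global dimension of the incidence algebra of `P`, for `𝒳` the set of
spread modules of the class `k`. -/
def spreadGlobalDim (K : Type u) [Field K] (k : SpreadClass) (P : Type) [PartialOrder P] : ℕ∞ :=
  relGlobalDim (pwfd K P) (modulesOf K (k.spreads P))

/-! ### The grid and its Koszul-type complex -/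

/-- The segment `⟨(1,1), (n,n)⟩` in `ℕ²`. -/
abbrev Grid (n : ℕ) : Type := Set.Icc ((1, 1) : ℕ × ℕ) (n, n)

section Koszul

variable {n : ℕ}

/-- The point `(1,1)` of the grid. -/
def corner (hn : 1 < n) : Grid n := ⟨(1, 1), ⟨le_rfl, ⟨hn.le, hn.le⟩⟩⟩

/-- The points `(i, n + 1 - i)` for `1 ≤ i ≤ n`, numbered by `i - 1`. -/
def antidiag (i : Fin n) : Grid n :=
  ⟨(i.1 + 1, n - i.1), ⟨⟨by simp, Nat.le_sub_of_add_le (by omega)⟩, ⟨i.2, Nat.sub_le _ _⟩⟩⟩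

lemma antidiag_eq_of_le {i j : Fin n} (h : antidiag i ≤ antidiag j) : i = j := by
  have h1 : i.1 + 1 ≤ j.1 + 1 := h.1
  have h2 : n - i.1 ≤ n - j.1 := h.2
  apply Fin.ext
  omega

/-- For a set `B'` of points on the antidiagonal `B`, the spread `⟨(1,1), B⟩ \ B'`. -/
def koszulSpread (hn : 1 < n) (B' : Finset (Fin n)) : Spread (Grid n) where
  carrier := segRegion {corner hn} (Set.range antidiag) \ antidiag '' (B' : Set (Fin n))
  nonempty := by
    refine ⟨corner hn, ⟨⟨_, rfl, le_rfl⟩, _, ⟨⟨0, by omega⟩, rfl⟩, (antidiag _).2.1⟩, ?_⟩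
    rintro ⟨i, -, hi⟩
    have h1 : i.1 + 1 = 1 := congrArg (fun z : Grid n => z.1.1) hi
    have h2 : n - i.1 = 1 := congrArg (fun z : Grid n => z.1.2) hi
    omega
  convex := by
    refine ⟨?_⟩
    rintro x ⟨-, -⟩ y ⟨⟨-, _, ⟨i, rfl⟩, hi⟩, hy⟩ z ⟨-, hzy⟩
    refine ⟨⟨⟨_, rfl, z.2.1⟩, _, ⟨i, rfl⟩, hzy.trans hi⟩, ?_⟩
    rintro ⟨j, hj, rfl⟩
    obtain rfl := antidiag_eq_of_le (hzy.trans hi)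
    exact hy ⟨j, hj, le_antisymm hzy hi⟩
  connected := by
    have hc : corner hn ∈
        segRegion {corner hn} (Set.range antidiag) \ antidiag '' (B' : Set (Fin n)) := by
      refine ⟨⟨⟨_, rfl, le_rfl⟩, _, ⟨⟨0, by omega⟩, rfl⟩, (antidiag _).2.1⟩, ?_⟩
      rintro ⟨i, -, hi⟩
      have h1 : i.1 + 1 = 1 := congrArg (fun z : Grid n => z.1.1) hi
      have h2 : n - i.1 = 1 := congrArg (fun z : Grid n => z.1.2) hi
      omega
    intro x hx y hy
    exact (Relation.ReflTransGen.single ⟨hx, hc, Or.inr x.2.1⟩).trans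
      (Relation.ReflTransGen.single ⟨hc, hy, Or.inl y.2.1⟩)

lemma koszulSpread_isQuotientOf (hn : 1 < n) {B₁ B₂ : Finset (Fin n)} (h : B₁ ⊆ B₂) :
    IsQuotientOf (koszulSpread hn B₁) (koszulSpread hn B₂) := by
  refine ⟨fun x hx => ⟨hx.1, fun hx' => hx.2 (Set.image_mono (by exact_mod_cast h) hx')⟩, ?_⟩
  rintro x ⟨hx, -⟩ y ⟨⟨-, _, ⟨i, rfl⟩, hi⟩, hy⟩ hxy
  refine ⟨hx, ?_⟩
  rintro ⟨j, hj, rfl⟩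
  obtain rfl := antidiag_eq_of_le (hxy.trans hi)
  exact hy ⟨j, hj, le_antisymm hxy hi⟩

variable (K : Type u) [Field K]

/-- The sign attached to removing from `B'` its `j`-th smallest element `i`. Here `j - 1` is the
number of elements of `B'` smaller than `i`, so this is `(-1)^(j+1)`. -/
def koszulSign (B' : Finset (Fin n)) (i : Fin n) : ℤ := (-1) ^ (B'.filter (· < i)).card

/-- The module `U^p`. -/
abbrev koszulX (hn : 1 < n) (p : ℕ) : PersMod K (Grid n) :=
  ⨁ fun B' : {B' : Finset (Fin n) // B'.card = p} => spreadModule K (koszulSpread hn B'.1)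

/-- The component of the differential from the summand of `B₁` to the summand of `B₂`: it is
`(-1)^(j+1)` times the canonical quotient map if `B₁` is obtained from `B₂` by removing its
`j`-th smallest element, and it is zero if `B₁` is not of this form. -/
def koszulComponent (hn : 1 < n) (B₁ B₂ : Finset (Fin n)) :
    spreadModule K (koszulSpread hn B₁) ⟶ spreadModule K (koszulSpread hn B₂) :=
  ∑ i : Fin n, if h : i ∈ B₂ ∧ B₁ = B₂.erase i then
    koszulSign B₂ i • quotMap K _ _ (koszulSpread_isQuotientOf hn
      (h.2.trans_subset (Finset.erase_subset i B₂)))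
  else 0

/-- The differential `U^p ⟶ U^(p+1)`. -/
def koszulD (hn : 1 < n) (p : ℕ) : koszulX K hn p ⟶ koszulX K hn (p + 1) :=
  biproduct.matrix fun B₁ B₂ => koszulComponent K hn B₁.1 B₂.1

lemma koszulSign_anticomm_aux (B : Finset (Fin n)) {i j : Fin n} (hij : i < j) (hi : i ∈ B) :
    koszulSign (B.erase j) i * koszulSign B j = -(koszulSign (B.erase i) j * koszulSign B i) := by
  have h1 : (B.erase j).filter (· < i) = B.filter (· < i) := by
    ext k
    simp only [Finset.mem_filter, Finset.mem_erase]
    exact ⟨fun h => ⟨h.1.2, h.2⟩, fun h => ⟨⟨(h.2.trans hij).ne, h.1⟩, h.2⟩⟩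
  have h2 : (B.erase i).filter (· < j) = (B.filter (· < j)).erase i := by
    ext k
    simp only [Finset.mem_filter, Finset.mem_erase]
    tauto
  have h3 := Finset.card_erase_add_one (Finset.mem_filter.2 ⟨hi, hij⟩ : i ∈ B.filter (· < j))
  unfold koszulSign
  rw [h1, h2, ← h3, pow_succ]
  ring

lemma koszulSign_anticomm (B : Finset (Fin n)) {i j : Fin n} (hij : i ≠ j) (hi : i ∈ B)
    (hj : j ∈ B) :
    koszulSign (B.erase j) i * koszulSign B j = -(koszulSign (B.erase i) j * koszulSign B i) := by
  rcases lt_or_gt_of_ne hij with h | h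
  · exact koszulSign_anticomm_aux B h hi
  · rw [koszulSign_anticomm_aux B h hj, neg_neg]

lemma koszulComponent_comp (hn : 1 < n) (p : ℕ) (B₁ B₃ : Finset (Fin n))
    (h₃ : B₃.card = p + 1 + 1) :
    ∑ B₂ : {B' : Finset (Fin n) // B'.card = p + 1},
      koszulComponent K hn B₁ B₂.1 ≫ koszulComponent K hn B₂.1 B₃ = 0 := by
  let T : Fin n × Fin n → (spreadModule K (koszulSpread hn B₁) ⟶
      spreadModule K (koszulSpread hn B₃)) := fun a =>
    if h : (a.1 ≠ a.2 ∧ a.1 ∈ B₃ ∧ a.2 ∈ B₃) ∧ B₁ = (B₃.erase a.2).erase a.1 then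
      (koszulSign (B₃.erase a.2) a.1 * koszulSign B₃ a.2) •
        quotMap K _ _ (koszulSpread_isQuotientOf hn
          (h.2.trans_subset ((Finset.erase_subset _ _).trans (Finset.erase_subset _ _))))
    else 0
  have hT : ∑ B₂ : {B' : Finset (Fin n) // B'.card = p + 1},
      koszulComponent K hn B₁ B₂.1 ≫ koszulComponent K hn B₂.1 B₃ = ∑ a, T a := by
    simp_rw [koszulComponent, Preadditive.sum_comp, Preadditive.comp_sum]
    rw [Finset.sum_comm, Fintype.sum_prod_type]
    refine Finset.sum_congr rfl fun i _ => ?_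
    rw [Finset.sum_comm]
    refine Finset.sum_congr rfl fun j _ => ?_
    by_cases hj : j ∈ B₃
    · rw [Finset.sum_eq_single ⟨B₃.erase j, by rw [Finset.card_erase_of_mem hj, h₃]; rfl⟩]
      · rw [dif_pos (⟨hj, rfl⟩ : j ∈ B₃ ∧ B₃.erase j = B₃.erase j)]
        by_cases hi : i ∈ B₃.erase j ∧ B₁ = (B₃.erase j).erase i
        · have hi' := Finset.mem_erase.1 hi.1
          simp only [T]
          rw [dif_pos hi, dif_pos ⟨⟨hi'.1, hi'.2, hj⟩, hi.2⟩, Preadditive.zsmul_comp,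
            Preadditive.comp_zsmul, smul_smul, quotMap_comp]
        · simp only [T]
          rw [dif_neg hi, zero_comp, dif_neg]
          exact fun h => hi ⟨Finset.mem_erase.2 ⟨h.1.1, h.1.2.1⟩, h.2⟩
      · intro B₂ _ hB
        rw [dif_neg (fun h => hB (Subtype.ext h.2) : ¬ (j ∈ B₃ ∧ B₂.1 = B₃.erase j)), comp_zero]
      · exact fun h => absurd (Finset.mem_univ _) h
    · simp only [T]
      rw [dif_neg (fun h => hj h.1.2.2)]
      refine Finset.sum_eq_zero fun B₂ _ => ?_
      rw [dif_neg (fun h => hj h.1 : ¬ (j ∈ B₃ ∧ B₂.1 = B₃.erase j)), comp_zero]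
  rw [hT]
  refine Finset.sum_involution (fun a _ => a.swap) ?_ ?_ (fun _ _ => Finset.mem_univ _)
    (fun a _ => a.swap_swap)
  · rintro ⟨i, j⟩ -
    by_cases h : (i ≠ j ∧ i ∈ B₃ ∧ j ∈ B₃) ∧ B₁ = (B₃.erase j).erase i
    · simp only [T, Prod.swap]
      rw [dif_pos h, dif_pos ⟨⟨h.1.1.symm, h.1.2.2, h.1.2.1⟩, h.2.trans Finset.erase_right_comm⟩,
        koszulSign_anticomm B₃ h.1.1 h.1.2.1 h.1.2.2, neg_smul, neg_add_cancel]
    · simp only [T, Prod.swap]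
      rw [dif_neg h, dif_neg, add_zero]
      exact fun h' => h ⟨⟨h'.1.1.symm, h'.1.2.2, h'.1.2.1⟩,
        h'.2.trans Finset.erase_right_comm⟩
  · rintro ⟨i, j⟩ - h hs
    refine h (dif_neg fun h' => h'.1.1 ?_)
    exact congrArg Prod.snd hs

lemma koszulD_comp (hn : 1 < n) (p : ℕ) : koszulD K hn p ≫ koszulD K hn (p + 1) = 0 := by
  refine biproduct.hom_ext' _ _ fun B₁ => biproduct.hom_ext _ _ fun B₃ => ?_
  rw [comp_zero, zero_comp, koszulD, koszulD, Category.assoc, Category.assoc,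
    biproduct.matrix_π, ← Category.assoc, biproduct.ι_matrix, biproduct.lift_desc]
  exact koszulComponent_comp K hn p B₁.1 B₃.1 B₃.2

/-- The Koszul-type cochain complex `U`. -/
def koszulComplex (hn : 1 < n) : CochainComplex (PersMod K (Grid n)) ℕ :=
  CochainComplex.of (koszulX K hn) (koszulD K hn) (koszulD_comp K hn)

end Koszul

end SpreadRes

end

open SpreadRes

noncomputable section

namespace SpreadRes

universe v u

attribute [local instance] Abelian.hasFiniteBiproducts

/-! ### Principal up-sets, principal down-sets and lower sets as spreads. -/

section Spreads

variable {P : Type} [PartialOrder P]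

/-! Write `S` for the full spread. Each `S \ B'` is a lower set with the corner as least point, so a
morphism from its module to a spread module `I_T` is determined by the scalar it induces at the
corner, and this can be nonzero only if `T` contains the corner and `T ⊆ S \ B'`. Thus Hom(U, I_T)
is a complex of families of scalars indexed by subsets of the antidiagonal, with a support
condition. If some `x_m` is not in `T`, the support condition does not see `x_m`, and adding or
removing `m` gives a contracting homotopy (`koszul_contract`, `exists_factor_of_antidiag_notMem`).
If `T` contains the whole antidiagonal, only the empty subset can contribute, and by convexity it
does so only for `T = S`. So Hom(U, I_T) is acyclic for `T ≠ S`, and for `T = S` its only cohomology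
is a copy of `K` in degree 0 (`exists_factor_succ`, `exists_factor_zero`).

The modules of principal down-sets cogenerate, and none of them is `I_S`; hence U is exact. Summing
over all `T`, the complex Hom(U, G) is a projective resolution of the simple top of Hom(I_S, G). It
is minimal because Hom(U^(p+1), U^p) = 0 (`koszulX_hom_eq_zero`): an endomorphism that is the
identity modulo boundaries is the identity. The projective dimension is read off from a minimal
resolution.

For the lower bound let `n = m + 2` and let `Z` be the kernel of U^(m+1) → U^(m+2). A minimal
relative resolution of `Z` of length less than `m` would, by dimension shifting, make Hom(U, Z)
exact in degree `m`. Then U^m → Z factors through U^(m+1), and the vanishing of Hom(U^(p+1), U^p)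
forces first that U^(m+1) → U^(m+2) is zero and then that U^n = 0, which is false. Since `relDim` is
a supremum over minimal resolutions, one must also exist; a Fitting argument supplies the covers
(`exists_isCover`). -/

lemma zigzagConnected_of_le {S : Set P} {x : P} (hx : x ∈ S) (h : ∀ y ∈ S, x ≤ y) :
    ZigzagConnected S := fun y hy z hz =>
  (Relation.ReflTransGen.single ⟨hy, hx, Or.inr (h y hy)⟩).trans
    (Relation.ReflTransGen.single ⟨hx, hz, Or.inl (h z hz)⟩)

lemma zigzagConnected_of_ge {S : Set P} {x : P} (hx : x ∈ S) (h : ∀ y ∈ S, y ≤ x) :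
    ZigzagConnected S := fun y hy z hz =>
  (Relation.ReflTransGen.single ⟨hy, hx, Or.inl (h y hy)⟩).trans
    (Relation.ReflTransGen.single ⟨hx, hz, Or.inr (h z hz)⟩)

/-- The spread of all points above `x`. -/
def upSpread (x : P) : Spread P where
  carrier := Set.Ici x
  nonempty := Set.nonempty_Ici
  convex := Set.ordConnected_Ici
  connected := zigzagConnected_of_le (Set.mem_Ici.2 le_rfl) fun _ h => h

/-- The spread of all points below `x`. -/
def downSpread (x : P) : Spread P where
  carrier := Set.Iic x
  nonempty := Set.nonempty_Iic
  convex := Set.ordConnected_Iic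
  connected := zigzagConnected_of_ge (Set.mem_Iic.2 le_rfl) fun _ h => h

lemma upSpread_isSingleSource (x : P) : (upSpread x).IsSingleSource :=
  ⟨x, Or.inl (Set.ext fun c => by simp [upSpread, upRegion])⟩

/-- In a finite poset with a least element, each spread which is a lower set is single-source. -/
lemma isSingleSource_of_isLowerSet [Finite P] {x : P} (hx : ∀ y, x ≤ y) (S : Spread P)
    (hS : IsLowerSet S.carrier) : S.IsSingleSource := by
  refine ⟨x, ?_⟩
  by_cases h : S.carrier = Set.univ
  · exact Or.inl (by rw [h]; ext c; simp [upRegion, hx])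
  · obtain ⟨y, hy⟩ := (Set.ne_univ_iff_exists_notMem _).1 h
    -- The antichain consists of the minimal points of the complement; by finiteness the complement
    -- is the up-set they generate.
    refine Or.inr ⟨{b | Minimal (· ∈ S.carrierᶜ) b}, Set.toFinite _, setOfPred_minimal_antichain _,
      ?_, ?_⟩
    · obtain ⟨b, -, hb⟩ := (Set.toFinite (S.carrierᶜ)).exists_le_minimal hy
      exact ⟨b, hb, hx b⟩
    · ext c
      constructor
      · exact fun hc => ⟨⟨x, rfl, hx c⟩, fun ⟨b, hb, hbc⟩ => hb.prop (hS hbc hc)⟩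
      · rintro ⟨-, hc⟩
        by_contra hc'
        obtain ⟨b, hbc, hb⟩ := (Set.toFinite (S.carrierᶜ)).exists_le_minimal hc'
        exact hc ⟨b, hb, hbc⟩

end Spreads

/-! ### The spreads `S \ B'` in the grid. -/

section Grid

variable {n : ℕ}

lemma corner_le (hn : 1 < n) (y : Grid n) : corner hn ≤ y := y.2.1

lemma mem_koszulSpread (hn : 1 < n) {B : Finset (Fin n)} {x : Grid n} :
    x ∈ (koszulSpread hn B).carrier ↔ (∃ i, x ≤ antidiag i) ∧ ∀ i ∈ B, x ≠ antidiag i := by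
  constructor
  · rintro ⟨⟨-, _, ⟨i, rfl⟩, hi⟩, h⟩
    exact ⟨⟨i, hi⟩, fun j hj hx => h ⟨j, hj, hx.symm⟩⟩
  · rintro ⟨⟨i, hi⟩, h⟩
    refine ⟨⟨⟨_, rfl, corner_le hn x⟩, _, ⟨i, rfl⟩, hi⟩, ?_⟩
    rintro ⟨j, hj, hx⟩
    exact h j hj hx.symm

lemma antidiag_injective : Function.Injective (antidiag (n := n)) :=
  fun _ _ h => antidiag_eq_of_le h.le

lemma antidiag_mem_koszulSpread (hn : 1 < n) {B : Finset (Fin n)} {i : Fin n} :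
    antidiag i ∈ (koszulSpread hn B).carrier ↔ i ∉ B := by
  rw [mem_koszulSpread]
  refine ⟨fun h hi => h.2 i hi rfl, fun h => ⟨⟨i, le_rfl⟩, fun j hj hij => ?_⟩⟩
  rw [antidiag_injective hij] at h
  exact h hj

lemma koszulSpread_isLowerSet (hn : 1 < n) (B : Finset (Fin n)) :
    IsLowerSet (koszulSpread hn B).carrier := by
  intro y x hxy hy
  rw [mem_koszulSpread] at hy ⊢
  obtain ⟨⟨i, hi⟩, h⟩ := hy
  refine ⟨⟨i, hxy.trans hi⟩, ?_⟩
  rintro j hj rfl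
  obtain rfl := antidiag_eq_of_le (hxy.trans hi)
  exact h j hj (le_antisymm hi hxy)

lemma corner_mem_koszulSpread (hn : 1 < n) (B : Finset (Fin n)) :
    corner hn ∈ (koszulSpread hn B).carrier := by
  obtain ⟨x, hx⟩ := (koszulSpread hn B).nonempty
  exact koszulSpread_isLowerSet hn B (corner_le hn x) hx

lemma koszulSpread_injective (hn : 1 < n) : Function.Injective (koszulSpread hn) := by
  intro B C h
  ext i
  rw [← not_iff_not, ← antidiag_mem_koszulSpread hn, ← antidiag_mem_koszulSpread hn, h]

lemma isSingleSource_of_isLowerSet_grid (hn : 1 < n) (S : Spread (Grid n))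
    (hS : IsLowerSet S.carrier) : S.IsSingleSource :=
  isSingleSource_of_isLowerSet (corner_le hn) S hS

lemma koszulSpread_isSingleSource (hn : 1 < n) (B : Finset (Fin n)) :
    (koszulSpread hn B).IsSingleSource :=
  isSingleSource_of_isLowerSet_grid hn _ (koszulSpread_isLowerSet hn B)

lemma downSpread_isSingleSource (hn : 1 < n) (x : Grid n) : (downSpread x).IsSingleSource :=
  isSingleSource_of_isLowerSet_grid hn _ (isLowerSet_Iic x)

end Grid

lemma SpreadClass.mem_spreads_of_isSingleSource (k : SpreadClass) {P : Type} [PartialOrder P]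
    {S : Spread P} (h : S.IsSingleSource) : S ∈ k.spreads P := by
  cases k
  · trivial
  · exact h

/-! ### Elements of spread modules; morphisms from principal up-sets and to principal down-sets. -/

section Modules

variable {K : Type u} [Field K] {P : Type}

lemma fiberMap_val_of_mem (S : Set P) {T : Set P} (x : P) {y : P} (hy : y ∈ T)
    (c : fiber K S x) : (fiberMap K S T x y c).1 = c.1 := if_pos hy

variable [PartialOrder P]

/-- The value in `K` of an element of a spread module. -/
def spreadVal (S : Spread P) (x : P) : (spreadModule K S).obj x →ₗ[K] K :=
  (fiber K S.carrier x).subtype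

lemma spreadVal_injective (S : Spread P) (x : P) :
    Function.Injective (spreadVal (K := K) S x) := Subtype.val_injective

lemma spreadVal_eq_zero (S : Spread P) {x : P} (hx : x ∉ S.carrier)
    (c : (spreadModule K S).obj x) : spreadVal S x c = 0 := Subtype.prop c hx

lemma spreadVal_map (S : Spread P) {x y : P} (f : x ⟶ y) (hy : y ∈ S.carrier)
    (c : (spreadModule K S).obj x) :
    spreadVal S y (((spreadModule K S).map f).hom c) = spreadVal S x c :=
  fiberMap_val_of_mem _ _ hy _

lemma spreadVal_quotMap {S T : Spread P} (h : IsQuotientOf S T) {x : P} (hx : x ∈ T.carrier)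
    (c : (spreadModule K S).obj x) :
    spreadVal T x (((quotMap K S T h).app x).hom c) = spreadVal S x c :=
  fiberMap_val_of_mem _ _ hx _

/-- The element with value `1` of a spread module. -/
def spreadGen {S : Spread P} {x : P} (hx : x ∈ S.carrier) : (spreadModule K S).obj x :=
  (⟨1, fun h => absurd hx h⟩ : fiber K S.carrier x)

lemma spreadVal_gen {S : Spread P} {x : P} (hx : x ∈ S.carrier) :
    spreadVal S x (spreadGen (K := K) hx) = 1 := rfl

lemma eq_smul_spreadGen {S : Spread P} {x : P} (hx : x ∈ S.carrier)
    (c : (spreadModule K S).obj x) : c = spreadVal S x c • spreadGen hx :=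
  spreadVal_injective S x (by rw [map_smul, spreadVal_gen, smul_eq_mul, mul_one])

lemma spreadModule_pwfd (S : Spread P) : pwfd K P (spreadModule K S) := fun x =>
  inferInstanceAs (FiniteDimensional K (fiber K S.carrier x))

open Classical in
/-- The components of `fromUp`. -/
def fromUpApp (M : PersMod K P) (x : P) (m : M.obj x) (y : P) :
    (spreadModule K (upSpread x)).obj y →ₗ[K] M.obj y :=
  if h : x ≤ y then (spreadVal (upSpread x) y).smulRight ((M.map (homOfLE h)).hom m) else 0

lemma fromUpApp_apply (M : PersMod K P) {x y : P} (m : M.obj x) (f : x ⟶ y)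
    (c : (spreadModule K (upSpread x)).obj y) :
    fromUpApp M x m y c = spreadVal (upSpread x) y c • (M.map f).hom m := by
  rw [fromUpApp, dif_pos (leOfHom f)]
  rfl

/-- The morphism from the projective module generated at `x` sending the generator to `m`. -/
def fromUp (M : PersMod K P) (x : P) (m : M.obj x) : spreadModule K (upSpread x) ⟶ M where
  app y := ModuleCat.ofHom (fromUpApp M x m y)
  naturality y z f := by
    refine ModuleCat.hom_ext (LinearMap.ext fun c => ?_)
    change fromUpApp M x m z (((spreadModule K (upSpread x)).map f).hom c) =
      (M.map f).hom (fromUpApp M x m y c)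
    by_cases hy : x ≤ y
    · have hz : x ≤ z := hy.trans (leOfHom f)
      rw [fromUpApp_apply M m (homOfLE hy), fromUpApp_apply M m (homOfLE hy ≫ f),
        spreadVal_map _ _ (show z ∈ (upSpread x).carrier from hz), map_smul, M.map_comp]
      rfl
    · have hc : c = 0 := spreadVal_injective _ _
        ((spreadVal_eq_zero (upSpread x) hy c).trans (map_zero _).symm)
      rw [hc, map_zero, map_zero, map_zero, map_zero]

lemma mem_upSpread (x : P) : x ∈ (upSpread x).carrier := Set.mem_Ici.2 le_rfl

lemma mem_downSpread (x : P) : x ∈ (downSpread x).carrier := Set.mem_Iic.2 le_rfl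

lemma fromUp_apply (M : PersMod K P) (x : P) (m : M.obj x) :
    ((fromUp M x m).app x).hom (spreadGen (mem_upSpread x)) = m := by
  change fromUpApp M x m x (spreadGen (mem_upSpread x)) = m
  rw [fromUpApp_apply M m (𝟙 x), spreadVal_gen, one_smul, M.map_id]
  rfl

open Classical in
/-- The components of `toDown`. -/
def toDownApp (M : PersMod K P) (x : P) (l : M.obj x →ₗ[K] K) (y : P) :
    M.obj y →ₗ[K] (spreadModule K (downSpread x)).obj y :=
  if h : y ≤ x then (l ∘ₗ (M.map (homOfLE h)).hom).smulRight
      (spreadGen (show y ∈ (downSpread x).carrier from h)) else 0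

lemma spreadVal_toDownApp (M : PersMod K P) {x y : P} (l : M.obj x →ₗ[K] K) (f : y ⟶ x)
    (m : M.obj y) : spreadVal _ _ (toDownApp M x l y m) = l ((M.map f).hom m) := by
  rw [toDownApp, dif_pos (leOfHom f), LinearMap.smulRight_apply, map_smul, spreadVal_gen,
    smul_eq_mul, mul_one]
  rfl

/-- The morphism to the injective module cogenerated at `x` given by a linear form. -/
def toDown (M : PersMod K P) (x : P) (l : M.obj x →ₗ[K] K) :
    M ⟶ spreadModule K (downSpread x) where
  app y := ModuleCat.ofHom (toDownApp M x l y)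
  naturality y z f := by
    refine ModuleCat.hom_ext (LinearMap.ext fun c => spreadVal_injective _ _ ?_)
    change spreadVal _ _ (toDownApp M x l z ((M.map f).hom c)) =
      spreadVal _ _ (((spreadModule K (downSpread x)).map f).hom (toDownApp M x l y c))
    by_cases hz : z ≤ x
    · rw [spreadVal_map _ _ (show z ∈ (downSpread x).carrier from hz),
        spreadVal_toDownApp M l (homOfLE hz), spreadVal_toDownApp M l (f ≫ homOfLE hz), M.map_comp]
      rfl
    · rw [spreadVal_eq_zero _ hz, spreadVal_eq_zero _ hz]

lemma spreadVal_toDown (M : PersMod K P) (x : P) (l : M.obj x →ₗ[K] K) (m : M.obj x) :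
    spreadVal _ _ (((toDown M x l).app x).hom m) = l m := by
  refine (spreadVal_toDownApp M l (𝟙 x) m).trans ?_
  rw [M.map_id]
  rfl

/-- The modules `spreadModule K (downSpread x)` cogenerate the category of representations. -/
lemma eq_zero_of_comp_downSpread {A B : PersMod K P} (f : A ⟶ B)
    (h : ∀ x (g : B ⟶ spreadModule K (downSpread x)), f ≫ g = 0) : f = 0 := by
  ext x a
  refine (Module.forall_dual_apply_eq_zero_iff K _).1 fun l => ?_
  rw [← spreadVal_toDown]
  have := congrArg (fun t => spreadVal _ _ ((t.app x).hom a)) (h x (toDown B x l))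
  exact this.trans (map_zero _)

end Modules

/-! ### Closure properties of `addOf`. -/

section Relative

variable {C : Type u} [Category.{v} C] [Abelian C]

lemma addOf_of_retract {𝒳 : ObjectProperty C} {ι : Type} [Finite ι] (X : ι → C)
    (hX : ∀ i, 𝒳 (X i)) {U : C} (r : Retract U (⨁ X)) : addOf 𝒳 U := by
  obtain ⟨m, ⟨e⟩⟩ := Finite.exists_equiv_fin ι
  exact ⟨m, fun j => X (e.symm j), fun j => hX _,
    ⟨r.trans (biproduct.whiskerEquiv e fun j => eqToIso (by simp)).retract⟩⟩

lemma addOf_biproduct {𝒳 : ObjectProperty C} {ι : Type} [Finite ι] (X : ι → C)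
    (hX : ∀ i, 𝒳 (X i)) : addOf 𝒳 (⨁ X) := addOf_of_retract X hX (Retract.refl _)

lemma addOf_retract {𝒳 : ObjectProperty C} {U V : C} (r : Retract U V) (h : addOf 𝒳 V) :
    addOf 𝒳 U := by
  obtain ⟨m, X, hX, ⟨s⟩⟩ := h
  exact ⟨m, X, hX, ⟨r.trans s⟩⟩

lemma addOf_of_mem {𝒳 : ObjectProperty C} {X : C} (h : 𝒳 X) : addOf 𝒳 X :=
  addOf_of_retract (fun _ : Unit => X) (fun _ => h)
    ⟨biproduct.ι (fun _ : Unit => X) (), biproduct.π _ (), biproduct.ι_π_self _ _⟩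

end Relative

/-! ### Projectives and injectives as sums of spread modules. -/

section GeneratorCogenerator

variable {K : Type u} [Field K] {P : Type} [PartialOrder P]

lemma modulesOf_spreadModule {F : Set (Spread P)} {S : Spread P} (h : S ∈ F) :
    modulesOf K F (spreadModule K S) := ⟨S, h, ⟨Iso.refl _⟩⟩

variable [Finite P]

/-- The index type of a family of bases of the spaces of a representation. -/
abbrev BasisIndex (M : PersMod K P) : Type := Σ x : P, Fin (Module.finrank K (M.obj x))

/-- The morphism from a direct sum of projective modules given by bases. -/
def upCover (M : PersMod K P) (hM : pwfd K P M) :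
    (⨁ fun a : BasisIndex M => spreadModule K (upSpread a.1)) ⟶ M :=
  biproduct.desc fun a => fromUp M a.1 (have := hM a.1; Module.finBasis K (M.obj a.1) a.2)

/-- A morphism annihilated by `upCover` kills a basis of `M` at every point. -/
lemma upCover_epi (M : PersMod K P) (hM : pwfd K P M) : Epi (upCover M hM) := by
  refine Preadditive.epi_of_cancel_zero _ fun {B} g hg => ?_
  ext x : 2
  refine ModuleCat.hom_ext ?_
  have := hM x
  refine (Module.finBasis K (M.obj x)).ext fun i => ?_
  have h1 : fromUp M x (Module.finBasis K (M.obj x) i) ≫ g = 0 := by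
    have h := congrArg (fun t => biproduct.ι (fun a : BasisIndex M =>
      spreadModule K (upSpread a.1)) ⟨x, i⟩ ≫ t) hg
    simpa only [upCover, comp_zero, biproduct.ι_desc_assoc] using h
  have h2 := congrArg (fun t => (t.app x).hom (spreadGen (mem_upSpread x))) h1
  have h3 := congrArg (g.app x).hom (fromUp_apply M x (Module.finBasis K (M.obj x) i))
  exact h3.symm.trans h2

/-- The morphism to a direct sum of injective modules given by dual bases. -/
def downHull (M : PersMod K P) (hM : pwfd K P M) :
    M ⟶ (⨁ fun a : BasisIndex M => spreadModule K (downSpread a.1)) :=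
  biproduct.lift fun a => toDown M a.1
    (have := hM a.1; (Module.finBasis K (M.obj a.1)).coord a.2)

lemma downHull_mono (M : PersMod K P) (hM : pwfd K P M) : Mono (downHull M hM) := by
  refine Preadditive.mono_of_cancel_zero _ fun {B} g hg => ?_
  ext x b
  have := hM x
  refine (Module.finBasis K (M.obj x)).ext_elem fun i => ?_
  have h1 : g ≫ toDown M x ((Module.finBasis K (M.obj x)).coord i) = 0 := by
    have h := congrArg (fun t => t ≫ biproduct.π (fun a : BasisIndex M =>
      spreadModule K (downSpread a.1)) ⟨x, i⟩) hg
    simpa only [downHull, zero_comp, Category.assoc, biproduct.lift_π] using h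
  have h2 := congrArg (fun t => spreadVal _ _ ((t.app x).hom b)) h1
  have h3 := spreadVal_toDown M x ((Module.finBasis K (M.obj x)).coord i) ((g.app x).hom b)
  have h4 := h3.symm.trans (h2.trans (map_zero _))
  rw [Module.Basis.coord_apply] at h4
  exact h4.trans (by simp)

/-- The epimorphism `upCover` onto a projective splits; dually, `downHull` splits for an injective.
-/
lemma addOf_of_projective {F : Set (Spread P)} (hF : ∀ x, upSpread x ∈ F) {Q : PersMod K P}
    (hQ : pwfd K P Q) [Projective Q] : addOf (modulesOf K F) Q := by
  have := upCover_epi Q hQ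
  have r : Retract Q (⨁ fun a : BasisIndex Q => spreadModule K (upSpread a.1)) :=
    ⟨Projective.factorThru (𝟙 Q) (upCover Q hQ), upCover Q hQ, Projective.factorThru_comp _ _⟩
  exact addOf_of_retract (fun a : BasisIndex Q => spreadModule K (upSpread a.1))
    (fun a => modulesOf_spreadModule (hF a.1)) r

lemma addOf_of_injective {F : Set (Spread P)} (hF : ∀ x, downSpread x ∈ F) {Q : PersMod K P}
    (hQ : pwfd K P Q) [Injective Q] : addOf (modulesOf K F) Q := by
  have := downHull_mono Q hQ
  have r : Retract Q (⨁ fun a : BasisIndex Q => spreadModule K (downSpread a.1)) :=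
    ⟨downHull Q hQ, Injective.factorThru (𝟙 Q) (downHull Q hQ), Injective.comp_factorThru _ _⟩
  exact addOf_of_retract (fun a : BasisIndex Q => spreadModule K (downSpread a.1))
    (fun a => modulesOf_spreadModule (hF a.1)) r

end GeneratorCogenerator

/-! ### Morphisms between spread modules as scalars. -/

section HomVal

variable {K : Type u} [Field K] {P : Type} [PartialOrder P]

/-- The value at a point `o` of a morphism between spread modules. -/
def homVal {L : Spread P} {o : P} (ho : o ∈ L.carrier) (T : Spread P) :
    (spreadModule K L ⟶ spreadModule K T) →+ K where
  toFun f := spreadVal T o ((f.app o).hom (spreadGen ho))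
  map_zero' := map_zero _
  map_add' f g := map_add (spreadVal T o) ((f.app o).hom (spreadGen ho))
    ((g.app o).hom (spreadGen ho))

lemma homVal_apply {L : Spread P} {o : P} (ho : o ∈ L.carrier) {T : Spread P}
    (f : spreadModule K L ⟶ spreadModule K T) :
    homVal ho T f = spreadVal T o ((f.app o).hom (spreadGen ho)) := rfl

/-- Naturality along `o ⟶ y` carries the scalar at `o` to `y`, because the structure maps preserve
values inside both spreads. -/
lemma spreadVal_app {L : Spread P} {o : P} (ho : o ∈ L.carrier) {T : Spread P}
    (f : spreadModule K L ⟶ spreadModule K T) {y : P} (g : o ⟶ y) (hL : y ∈ L.carrier)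
    (hT : y ∈ T.carrier) (c : (spreadModule K L).obj y) :
    spreadVal T y ((f.app y).hom c) = spreadVal L y c * homVal ho T f := by
  have h : ((spreadModule K L).map g).hom (spreadGen ho) = spreadGen hL :=
    spreadVal_injective _ _ (by rw [spreadVal_map _ _ hL]; rfl)
  have h' : (f.app y).hom (((spreadModule K L).map g).hom (spreadGen ho)) =
      ((spreadModule K T).map g).hom ((f.app o).hom (spreadGen ho)) :=
    congrArg (fun t => t.hom (spreadGen ho)) (f.naturality g)
  rw [homVal_apply, ← spreadVal_map T g hT, ← h', h, ← smul_eq_mul, ← map_smul, ← map_smul,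
    ← eq_smul_spreadGen hL c]

/-- If `o` is the least point of `L`, the spread module is generated at `o`, so a morphism is
determined by one scalar. -/
lemma homVal_injective {L : Spread P} {o : P} (ho : o ∈ L.carrier) (h : ∀ y ∈ L.carrier, o ≤ y)
    (T : Spread P) : Function.Injective (homVal (K := K) ho T) := by
  refine (injective_iff_map_eq_zero _).2 fun f hf => ?_
  ext y c
  refine spreadVal_injective T y ((Eq.trans ?_ (map_zero _).symm))
  by_cases hL : y ∈ L.carrier
  · by_cases hT : y ∈ T.carrier
    · rw [spreadVal_app ho f (homOfLE (h y hL)) hL hT, hf, mul_zero]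
    · exact spreadVal_eq_zero T hT _
  · have hc : c = 0 := spreadVal_injective L y
      ((spreadVal_eq_zero L hL c).trans (map_zero _).symm)
    rw [hc, map_zero, map_zero]

lemma mem_of_homVal_ne_zero {L : Spread P} {o : P} (ho : o ∈ L.carrier) {T : Spread P}
    {f : spreadModule K L ⟶ spreadModule K T} (hf : homVal ho T f ≠ 0) : o ∈ T.carrier := by
  by_contra h
  exact hf (spreadVal_eq_zero T h _)

/-- At a point of `T` outside `L` the generator of the source has become zero, while the target has
transported its image with unchanged value; so that value is zero. -/
lemma subset_of_homVal_ne_zero {L : Spread P} {o : P} (ho : o ∈ L.carrier) {T : Spread P}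
    {f : spreadModule K L ⟶ spreadModule K T} (hf : homVal ho T f ≠ 0) (h : ∀ y, o ≤ y) :
    T.carrier ⊆ L.carrier := by
  intro y hy
  by_contra hL
  have h' : (f.app y).hom (((spreadModule K L).map (homOfLE (h y))).hom (spreadGen ho)) =
      ((spreadModule K T).map (homOfLE (h y))).hom ((f.app o).hom (spreadGen ho)) :=
    congrArg (fun t => t.hom (spreadGen ho)) (f.naturality (homOfLE (h y)))
  apply hf
  rw [homVal_apply, ← spreadVal_map T (homOfLE (h y)) hy, ← h']
  have h0 : ((spreadModule K L).map (homOfLE (h y))).hom (spreadGen ho) = 0 :=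
    spreadVal_injective L y ((spreadVal_eq_zero L hL _).trans (map_zero _).symm)
  rw [h0, map_zero, map_zero]

lemma homVal_quotMap_comp {L L' : Spread P} {o : P} (ho : o ∈ L.carrier) (ho' : o ∈ L'.carrier)
    (h : IsQuotientOf L L') {T : Spread P} (f : spreadModule K L' ⟶ spreadModule K T) :
    homVal ho T (quotMap K L L' h ≫ f) = homVal ho' T f := by
  have : ((quotMap K L L' h).app o).hom (spreadGen ho) = spreadGen ho' :=
    spreadVal_injective _ _ (by rw [spreadVal_quotMap h ho']; rfl)
  rw [homVal_apply, homVal_apply, ← this]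
  rfl

lemma homVal_smul {L : Spread P} {o : P} (ho : o ∈ L.carrier) {T : Spread P} (c : K)
    (f : spreadModule K L ⟶ spreadModule K T) : homVal ho T (c • f) = c * homVal ho T f :=
  map_smul (spreadVal T o) c ((f.app o).hom (spreadGen ho))

lemma homVal_quotMap {L T : Spread P} {o : P} (ho : o ∈ L.carrier) (hT : o ∈ T.carrier)
    (h : IsQuotientOf L T) : homVal ho T (quotMap K L T h) = 1 := by
  rw [homVal_apply, spreadVal_quotMap h hT]
  rfl

lemma homVal_id {L : Spread P} {o : P} (ho : o ∈ L.carrier) :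
    homVal ho L (𝟙 (spreadModule K L)) = 1 := rfl

/-- Convexity of `T` between the least point and any of its points makes it closed downwards, so the
necessary conditions for a nonzero morphism are also sufficient. -/
lemma isQuotientOf_of_subset {L T : Spread P} {o : P} (hT : o ∈ T.carrier) (h : ∀ y, o ≤ y)
    (hTL : T.carrier ⊆ L.carrier) : IsQuotientOf L T :=
  ⟨hTL, fun x _ _ hy hxy => T.convex.out hT hy ⟨h x, hxy⟩⟩

end HomVal

/-! ### The complexes Hom(U, I_T) in coordinates, and exactness of U. -/

section Coefficients

variable {n : ℕ} {K : Type u} [Field K]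

lemma koszulSign_mul_self (B : Finset (Fin n)) (i : Fin n) :
    koszulSign B i * koszulSign B i = 1 := by
  rw [koszulSign, ← pow_add, ← two_mul, pow_mul]
  simp

/-- The contracting homotopy of the Koszul complex of a family of coefficients. -/
lemma koszul_contract (c : Finset (Fin n) → K) (m : Fin n) (B : Finset (Fin n))
    (h : m ∈ B → ∑ i ∈ (B.erase m)ᶜ,
      (koszulSign (insert i (B.erase m)) i : K) * c (insert i (B.erase m)) = 0) :
    ∑ i ∈ Bᶜ, (koszulSign (insert i B) i : K) * (if m ∈ insert i B then
      (koszulSign (insert i B) m : K) * c ((insert i B).erase m) else 0) = c B := by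
  -- For `m ∈ B` the hypothesis is the cocycle condition at `B.erase m`: its term at `m` is a sign
  -- times `c B`, and by anticommutation of signs the remaining terms match the sum to be computed.
  by_cases hm : m ∈ B
  · have h1 : (B.erase m)ᶜ = insert m Bᶜ := Finset.compl_erase
    specialize h hm
    rw [h1, Finset.sum_insert (by simpa using hm), Finset.insert_erase hm] at h
    have h2 : ∀ i ∈ Bᶜ, (koszulSign (insert i B) i : K) * (if m ∈ insert i B then
        (koszulSign (insert i B) m : K) * c ((insert i B).erase m) else 0) =
        - (koszulSign B m : K) *
          ((koszulSign (insert i (B.erase m)) i : K) * c (insert i (B.erase m))) := by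
      intro i hi
      rw [Finset.mem_compl] at hi
      have him : i ≠ m := fun h => hi (h ▸ hm)
      rw [if_pos (Finset.mem_insert_of_mem hm)]
      have h3 := koszulSign_anticomm (insert i B) him (Finset.mem_insert_self i B)
        (Finset.mem_insert_of_mem hm)
      rw [Finset.erase_insert hi, Finset.erase_insert_of_ne him] at h3
      have h4 : (koszulSign (insert i B) i : K) * (koszulSign (insert i B) m : K) =
          - ((koszulSign B m : K) * (koszulSign (insert i (B.erase m)) i : K)) := by
        have h5 : koszulSign (insert i B) i * koszulSign (insert i B) m =
            - (koszulSign B m * koszulSign (insert i (B.erase m)) i) := by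
          have a := koszulSign_mul_self (insert i B) i
          have b := koszulSign_mul_self (insert i (B.erase m)) i
          calc _ = koszulSign (insert i B) i * koszulSign (insert i B) m *
                (koszulSign (insert i (B.erase m)) i * koszulSign (insert i (B.erase m)) i) := by
                  rw [b, mul_one]
            _ = koszulSign (insert i B) i * koszulSign (insert i (B.erase m)) i *
                (koszulSign (insert i (B.erase m)) i * koszulSign (insert i B) m) := by ring
            _ = -(koszulSign (insert i B) i * koszulSign (insert i B) i *
                (koszulSign (insert i (B.erase m)) i * koszulSign B m)) := by rw [h3]; ring
            _ = _ := by rw [a]; ring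
        exact_mod_cast congrArg (Int.cast (R := K)) h5
      rw [Finset.erase_insert_of_ne him, ← mul_assoc, h4]
      ring
    rw [Finset.sum_congr rfl h2, ← Finset.mul_sum,
      ← neg_eq_iff_eq_neg.2 (add_eq_zero_iff_eq_neg.1 h)]
    have h6 : (koszulSign B m : K) * (koszulSign B m : K) = 1 := by
      exact_mod_cast congrArg (Int.cast (R := K)) (koszulSign_mul_self B m)
    rw [neg_mul_neg, ← mul_assoc, h6, one_mul]
  -- For `m ∉ B` only the term adding `m` survives, and its two equal signs cancel; no cocycle
  -- condition is needed.
  · rw [Finset.sum_eq_single m]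
    · rw [if_pos (Finset.mem_insert_self m B), Finset.erase_insert hm, ← mul_assoc]
      have h6 : (koszulSign (insert m B) m : K) * (koszulSign (insert m B) m : K) = 1 := by
        exact_mod_cast congrArg (Int.cast (R := K)) (koszulSign_mul_self (insert m B) m)
      rw [h6, one_mul]
    · intro i _ him
      rw [if_neg, mul_zero]
      simp [hm, him.symm]
    · intro h
      simp [hm] at h

variable (hn : 1 < n)

/-- The coefficients of a morphism from `U^p` to a spread module. -/
def koszulCoeff {p : ℕ} {T : Spread (Grid n)} (f : koszulX K hn p ⟶ spreadModule K T)
    (B : Finset (Fin n)) : K :=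
  if h : B.card = p then
    homVal (corner_mem_koszulSpread hn B) T
      (biproduct.ι (fun B' : {B' : Finset (Fin n) // B'.card = p} =>
        spreadModule K (koszulSpread hn B'.1)) ⟨B, h⟩ ≫ f)
  -- Extending by zero to all cardinalities lets `insert` and `erase` be applied to index sets
  -- without cardinality proofs.
  else 0

lemma koszul_homVal_injective (B : Finset (Fin n)) (T : Spread (Grid n)) :
    Function.Injective (homVal (K := K) (corner_mem_koszulSpread hn B) T) :=
  homVal_injective _ (fun y _ => corner_le hn y) T

lemma koszulX_hom_ext {p : ℕ} {T : Spread (Grid n)} {f g : koszulX K hn p ⟶ spreadModule K T}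
    (h : ∀ B : Finset (Fin n), B.card = p → koszulCoeff hn f B = koszulCoeff hn g B) : f = g := by
  refine biproduct.hom_ext' _ _ fun B => koszul_homVal_injective hn _ _ ?_
  have := h B.1 B.2
  rwa [koszulCoeff, koszulCoeff, dif_pos B.2, dif_pos B.2] at this

lemma koszulCoeff_zero {p : ℕ} {T : Spread (Grid n)} (B : Finset (Fin n)) :
    koszulCoeff hn (0 : koszulX K hn p ⟶ spreadModule K T) B = 0 := by
  rw [koszulCoeff]
  split_ifs
  · rw [comp_zero, map_zero]
  · rfl

lemma subset_of_koszulCoeff_ne_zero {p : ℕ} {T : Spread (Grid n)}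
    {f : koszulX K hn p ⟶ spreadModule K T} {B : Finset (Fin n)} (h : koszulCoeff hn f B ≠ 0) :
    B.card = p ∧ corner hn ∈ T.carrier ∧ T.carrier ⊆ (koszulSpread hn B).carrier := by
  rw [koszulCoeff] at h
  split_ifs at h with hB
  · exact ⟨hB, mem_of_homVal_ne_zero _ h, subset_of_homVal_ne_zero _ h (corner_le hn)⟩
  · exact absurd rfl h

/-- Converse to `subset_of_koszulCoeff_ne_zero`: multiples of canonical surjections realise every
family with the right support. -/
lemma exists_koszulCoeff_eq {p : ℕ} {T : Spread (Grid n)} (c : Finset (Fin n) → K)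
    (hc : ∀ B, B.card = p → c B ≠ 0 →
      corner hn ∈ T.carrier ∧ T.carrier ⊆ (koszulSpread hn B).carrier) :
    ∃ f : koszulX K hn p ⟶ spreadModule K T, ∀ B, B.card = p → koszulCoeff hn f B = c B := by
  have : ∀ B : {B : Finset (Fin n) // B.card = p}, ∃ f : spreadModule K (koszulSpread hn B.1) ⟶
      spreadModule K T, homVal (corner_mem_koszulSpread hn B.1) T f = c B.1 := by
    intro B
    by_cases h : c B.1 = 0
    · exact ⟨0, by rw [h, map_zero]⟩
    · obtain ⟨h1, h2⟩ := hc B.1 B.2 h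
      exact ⟨c B.1 • quotMap K _ _ (isQuotientOf_of_subset h1 (corner_le hn) h2), by
        rw [homVal_smul, homVal_quotMap _ h1, mul_one]⟩
  choose f hf using this
  refine ⟨biproduct.desc f, fun B hB => ?_⟩
  rw [koszulCoeff, dif_pos hB, biproduct.ι_desc]
  exact hf ⟨B, hB⟩

lemma koszulComponent_homVal (B₁ B₂ : Finset (Fin n)) {T : Spread (Grid n)}
    (f : spreadModule K (koszulSpread hn B₂) ⟶ spreadModule K T) :
    homVal (corner_mem_koszulSpread hn B₁) T (koszulComponent K hn B₁ B₂ ≫ f) =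
      ∑ i, if i ∈ B₂ ∧ B₁ = B₂.erase i then
        (koszulSign B₂ i : K) * homVal (corner_mem_koszulSpread hn B₂) T f else 0 := by
  rw [koszulComponent, Preadditive.sum_comp, map_sum]
  refine Finset.sum_congr rfl fun i _ => ?_
  split_ifs with h
  · rw [Preadditive.zsmul_comp, map_zsmul,
      homVal_quotMap_comp _ (corner_mem_koszulSpread hn B₂), zsmul_eq_mul]
  · rw [zero_comp, map_zero]

/-- The differential leaves the summand of `B` only towards the sets obtained by adding one point;
so precomposition with it is a signed sum over the added point. -/
lemma koszulCoeff_comp {p : ℕ} {T : Spread (Grid n)}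
    (f : koszulX K hn (p + 1) ⟶ spreadModule K T) (B : Finset (Fin n)) (hB : B.card = p) :
    koszulCoeff hn (koszulD K hn p ≫ f) B =
      ∑ i ∈ Bᶜ, (koszulSign (insert i B) i : K) * koszulCoeff hn f (insert i B) := by
  rw [koszulCoeff, dif_pos hB, koszulD, biproduct.ι_matrix_assoc, biproduct.lift_eq,
    Preadditive.sum_comp, map_sum]
  simp_rw [Category.assoc, koszulComponent_homVal]
  rw [Finset.sum_comm, ← Finset.sum_subset (Finset.subset_univ Bᶜ)]
  · refine Finset.sum_congr rfl fun i hi => ?_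
    rw [Finset.mem_compl] at hi
    have hc : (insert i B).card = p + 1 := by rw [Finset.card_insert_of_notMem hi, hB]
    rw [Finset.sum_eq_single ⟨insert i B, hc⟩]
    · rw [if_pos ⟨Finset.mem_insert_self i B, (Finset.erase_insert hi).symm⟩, koszulCoeff,
        dif_pos hc]
    · rintro B₂ - hB₂
      rw [if_neg]
      rintro ⟨h1, h2⟩
      exact hB₂ (Subtype.ext ((Finset.insert_erase h1).symm.trans (congrArg (insert i) h2.symm)))
    · exact fun h => absurd (Finset.mem_univ _) h
  · intro i _ hi
    rw [Finset.mem_compl, not_not] at hi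
    refine Finset.sum_eq_zero fun B₂ _ => if_neg ?_
    rintro ⟨-, h2⟩
    rw [h2] at hi
    simp at hi

/-- The preimage is the contracting homotopy at `m` applied to the coefficients of `f`. It is
supported where morphisms exist because `x_m ∉ T`: removing `x_m` from the source spread leaves `T`
inside it. The cocycle condition is required only at sets of `p - 1` points avoiding `m`, hence is
vacuous for `p = 0`. -/
lemma exists_factor_of_antidiag_notMem {p : ℕ} {T : Spread (Grid n)} {m : Fin n}
    (hm : antidiag m ∉ T.carrier) (f : koszulX K hn p ⟶ spreadModule K T)
    (hf : ∀ B : Finset (Fin n), m ∉ B → B.card + 1 = p →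
      ∑ i ∈ Bᶜ, (koszulSign (insert i B) i : K) * koszulCoeff hn f (insert i B) = 0) :
    ∃ g, koszulD K hn p ≫ g = f := by
  obtain ⟨g, hg⟩ := exists_koszulCoeff_eq hn (p := p + 1) (T := T) (fun B => if m ∈ B then
    (koszulSign B m : K) * koszulCoeff hn f (B.erase m) else 0) (by
      intro B _ h
      split_ifs at h with hmB
      · obtain ⟨-, h1, h2⟩ := subset_of_koszulCoeff_ne_zero hn (right_ne_zero_of_mul h)
        refine ⟨h1, fun x hx => ?_⟩
        have hx' := (mem_koszulSpread hn).1 (h2 hx)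
        refine (mem_koszulSpread hn).2 ⟨hx'.1, fun i hi hxi => ?_⟩
        by_cases him : i = m
        · rw [hxi, him] at hx
          exact hm hx
        · exact hx'.2 i (Finset.mem_erase.2 ⟨him, hi⟩) hxi
      · exact absurd rfl h)
  refine ⟨g, koszulX_hom_ext hn fun B hB => ?_⟩
  rw [koszulCoeff_comp hn g B hB, ← koszul_contract (koszulCoeff hn f) m B]
  · refine Finset.sum_congr rfl fun i hi => ?_
    rw [Finset.mem_compl] at hi
    rw [hg _ (by rw [Finset.card_insert_of_notMem hi, hB])]
  · exact fun h => hf _ (Finset.notMem_erase m B) (by rw [Finset.card_erase_add_one h, hB])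

lemma koszulCoeff_eq_zero_of_antidiag_mem {p : ℕ} {T : Spread (Grid n)}
    (hT : ∀ i, antidiag i ∈ T.carrier) (f : koszulX K hn p ⟶ spreadModule K T)
    {B : Finset (Fin n)} (hB : B.Nonempty) : koszulCoeff hn f B = 0 := by
  by_contra h
  obtain ⟨i, hi⟩ := hB
  exact (antidiag_mem_koszulSpread hn).1 ((subset_of_koszulCoeff_ne_zero hn h).2.2 (hT i)) hi

/-- The complex `Hom(U, X)` is exact in positive degrees for each spread module `X`. -/
lemma exists_factor_succ {p : ℕ} {T : Spread (Grid n)}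
    (f : koszulX K hn (p + 1) ⟶ spreadModule K T) (hf : koszulD K hn p ≫ f = 0) :
    ∃ g, koszulD K hn (p + 1) ≫ g = f := by
  by_cases h : ∀ i, antidiag i ∈ T.carrier
  · refine ⟨0, koszulX_hom_ext hn fun B hB => ?_⟩
    rw [comp_zero, koszulCoeff_zero, koszulCoeff_eq_zero_of_antidiag_mem hn h f
      (Finset.card_pos.1 (by omega))]
  · push Not at h
    obtain ⟨m, hm⟩ := h
    refine exists_factor_of_antidiag_notMem hn hm f fun B _ hB => ?_
    rw [← koszulCoeff_comp hn f B (by omega), hf, koszulCoeff_zero]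

/-- The complex `Hom(U, X)` is exact in degree zero for each spread module `X` different from
`U^0`. -/
lemma exists_factor_zero {T : Spread (Grid n)} (hT : T ≠ koszulSpread hn ∅)
    (f : koszulX K hn 0 ⟶ spreadModule K T) : ∃ g, koszulD K hn 0 ≫ g = f := by
  -- If `T` contains the antidiagonal, a nonzero coefficient puts the corner in `T` and `T` inside
  -- `S`; convexity then gives `T = S`, which is excluded.
  by_cases h : ∀ i, antidiag i ∈ T.carrier
  · refine ⟨0, koszulX_hom_ext hn fun B hB => ?_⟩
    rw [comp_zero, koszulCoeff_zero]
    by_contra hc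
    obtain ⟨-, h1, h2⟩ := subset_of_koszulCoeff_ne_zero hn (Ne.symm hc)
    rw [Finset.card_eq_zero.1 hB] at h2
    refine hT (Spread.ext (h2.antisymm fun x hx => ?_))
    obtain ⟨⟨i, hi⟩, -⟩ := (mem_koszulSpread hn).1 hx
    exact T.convex.out h1 (h i) ⟨corner_le hn x, hi⟩
  · push Not at h
    obtain ⟨m, hm⟩ := h
    exact exists_factor_of_antidiag_notMem hn hm f fun B _ hB => absurd hB (by omega)

/-- A nonzero component from `S \ B` to `S \ C` needs `S \ C ⊆ S \ B`, that is `B ⊆ C`, which the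
cardinalities `p + 1` and `p` forbid. This is the source of minimality and of the final
contradiction in the lower bound. -/
lemma koszulX_hom_eq_zero {p : ℕ} (f : koszulX K hn (p + 1) ⟶ koszulX K hn p) : f = 0 := by
  refine biproduct.hom_ext _ _ fun C => koszulX_hom_ext hn fun B hB => ?_
  rw [zero_comp, koszulCoeff_zero]
  by_contra h
  have h1 := (subset_of_koszulCoeff_ne_zero hn h).2.2
  have h2 : B ⊆ C.1 := fun i hi => by
    by_contra hC
    exact (antidiag_mem_koszulSpread hn).1 (h1 ((antidiag_mem_koszulSpread hn).2 hC)) hi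
  have := Finset.card_le_card h2
  have := C.2
  omega

lemma koszulX_isZero {p : ℕ} (hp : n < p) : IsZero (koszulX K hn p) := by
  rw [IsZero.iff_id_eq_zero]
  refine biproduct.hom_ext _ _ fun C => ?_
  have := Finset.card_le_univ C.1
  rw [Fintype.card_fin, C.2] at this
  omega

/-- A principal down-set has a greatest point, but `S` has distinct maximal points `x_1` and `x_2`.
-/
lemma downSpread_ne_koszulSpread (x : Grid n) : downSpread x ≠ koszulSpread hn ∅ := by
  intro h
  have h1 : ∀ i : Fin n, antidiag i ≤ x := fun i => by
    have : antidiag i ∈ (downSpread x).carrier := by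
      rw [h, antidiag_mem_koszulSpread]
      exact Finset.notMem_empty i
    exact this
  have h2 : x ∈ (koszulSpread hn ∅).carrier := h ▸ mem_downSpread x
  obtain ⟨⟨i, hi⟩, -⟩ := (mem_koszulSpread hn).1 h2
  have h3 := antidiag_eq_of_le ((h1 ⟨0, by omega⟩).trans hi)
  have h4 := antidiag_eq_of_le ((h1 ⟨1, hn⟩).trans hi)
  rw [← h4, Fin.mk.injEq] at h3
  omega

lemma koszulComplex_d (p : ℕ) : (koszulComplex K hn).d p (p + 1) = koszulD K hn p :=
  CochainComplex.of_d _ _ p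

/-- Exactness means that the kernel inclusion followed by the cokernel projection vanishes, which is
tested on maps `g` to the cogenerators. The projection followed by `g` kills the incoming
differential, so it factors through the outgoing one, which the kernel kills. -/
lemma koszulComplex_exactAt (p : ℕ) : (koszulComplex K hn).ExactAt p := by
  cases p with
  | zero =>
    rw [HomologicalComplex.exactAt_iff' _ 0 0 1 (by simp) (by simp),
      ShortComplex.exact_iff_kernel_ι_comp_cokernel_π_zero]
    refine eq_zero_of_comp_downSpread _ fun x g => ?_
    obtain ⟨h, hh⟩ := exists_factor_zero hn (downSpread_ne_koszulSpread hn x)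
      (cokernel.π ((koszulComplex K hn).sc' 0 0 1).f ≫ g)
    rw [Category.assoc]
    refine (congrArg (fun t => kernel.ι _ ≫ t) hh.symm).trans ?_
    refine (Category.assoc _ _ _).symm.trans ?_
    rw [← koszulComplex_d]
    refine (congrArg (fun t => t ≫ h) (kernel.condition ((koszulComplex K hn).sc' 0 0 1).g)).trans ?_
    exact zero_comp
  | succ p =>
    rw [HomologicalComplex.exactAt_iff' _ p (p + 1) (p + 2) (by simp) (by simp),
      ShortComplex.exact_iff_kernel_ι_comp_cokernel_π_zero]
    refine eq_zero_of_comp_downSpread _ fun x g => ?_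
    obtain ⟨h, hh⟩ := exists_factor_succ hn
      (cokernel.π ((koszulComplex K hn).sc' p (p + 1) (p + 2)).f ≫ g) (by
        rw [← koszulComplex_d]
        refine (Category.assoc _ _ _).symm.trans ?_
        refine (congrArg (fun t => t ≫ g) (cokernel.condition
          ((koszulComplex K hn).sc' p (p + 1) (p + 2)).f)).trans ?_
        exact zero_comp)
    rw [Category.assoc]
    refine (congrArg (fun t => kernel.ι _ ≫ t) hh.symm).trans ?_
    refine (Category.assoc _ _ _).symm.trans ?_
    rw [← koszulComplex_d]
    refine (congrArg (fun t => t ≫ h) (kernel.condition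
      ((koszulComplex K hn).sc' p (p + 1) (p + 2)).g)).trans ?_
    exact zero_comp

end Coefficients

/-! ### Minimal projective resolutions and projective dimension. -/

section MinimalResolutions

variable {C : Type u} [Category.{v} C] [Abelian C]

lemma resolutionLength_eq {U : ChainComplex C ℕ} {n : ℕ} (h : ∀ i ≤ n, ¬ IsZero (U.X i))
    (h' : IsZero (U.X (n + 1))) : resolutionLength U = n := by
  refine le_antisymm (iInf₂_le n h') (le_iInf₂ fun j hj => ?_)
  by_contra hlt
  have hlt' : j < n := by simpa using hlt
  exact h (j + 1) hlt' hj

lemma le_resolutionLength {U : ChainComplex C ℕ} {n : ℕ}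
    (h : ∀ j < n, ¬ IsZero (U.X (j + 1))) : (n : ℕ∞) ≤ resolutionLength U := by
  refine le_iInf₂ fun j hj => ?_
  by_contra hlt
  exact h j (by simpa using hlt) hj

/-- Over a zero object the zero endomorphism is compatible with the cover, hence is an automorphism.
-/
lemma isZero_of_isCover {𝒳 : ObjectProperty C} {U M : C} {f : U ⟶ M} (hf : IsCover 𝒳 f)
    (hM : IsZero M) : IsZero U := by
  have := hf.minimal 0 (hM.eq_of_tgt _ _)
  exact (isIsoZero_iff_source_target_isZero U U).1 this |>.1

/-- For a section `s` of the cover, the idempotent `f ≫ s` is compatible with `f`, so it is an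
automorphism and `f` is mono. -/
lemma isIso_of_isCover {𝒳 : ObjectProperty C} {U M : C} {f : U ⟶ M} (hf : IsCover 𝒳 f)
    [Projective M] : IsIso f := by
  have := hf.admissible.1
  let s := Projective.factorThru (𝟙 M) f
  have hs : s ≫ f = 𝟙 M := Projective.factorThru_comp _ _
  have h : IsIso (f ≫ s) := hf.minimal _ (by rw [Category.assoc, hs, Category.comp_id])
  have : Mono f := mono_of_mono f s
  exact isIso_of_mono_of_epi f

lemma shortExact_image {A B D : C} {f : A ⟶ B} {g : B ⟶ D} (w : f ≫ g = 0)
    (h : (ShortComplex.mk f g w).Exact) (w' : Abelian.image.ι f ≫ Abelian.factorThruImage g = 0) :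
    (ShortComplex.mk _ _ w').ShortExact := by
  have w'' : f ≫ Abelian.factorThruImage g = 0 := by
    rw [← cancel_mono (Abelian.image.ι g), Category.assoc, Abelian.image.fac, w, zero_comp]
  have h1 : (ShortComplex.mk f _ w'').Exact := by
    refine (ShortComplex.exact_iff_of_epi_of_isIso_of_mono (S₁ := ShortComplex.mk f _ w'')
      (S₂ := ShortComplex.mk f g w)
      { τ₁ := 𝟙 _, τ₂ := 𝟙 _, τ₃ := Abelian.image.ι g }).2 h
  have h2 : (ShortComplex.mk _ _ w').Exact := by
    refine (ShortComplex.exact_iff_of_epi_of_isIso_of_mono (S₁ := ShortComplex.mk f _ w'')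
      (S₂ := ShortComplex.mk _ _ w')
      { τ₁ := Abelian.factorThruImage f, τ₂ := 𝟙 _, τ₃ := 𝟙 _ }).1 h1
  exact { exact := h2, mono_f := inferInstance, epi_g := inferInstance }

lemma shortExact_image_of_epi {A B D : C} {f : A ⟶ B} {g : B ⟶ D} [Epi g] (w : f ≫ g = 0)
    (h : (ShortComplex.mk f g w).Exact) (w' : Abelian.image.ι f ≫ g = 0) :
    (ShortComplex.mk _ _ w').ShortExact :=
  { exact := (ShortComplex.exact_iff_of_epi_of_isIso_of_mono (S₁ := ShortComplex.mk f g w)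
      (S₂ := ShortComplex.mk _ _ w')
      { τ₁ := Abelian.factorThruImage f, τ₂ := 𝟙 _, τ₃ := 𝟙 _ }).1 h
    mono_f := inferInstance
    epi_g := inferInstance }

lemma image_ι_comp_eq_zero {A B D : C} {f : A ⟶ B} {g : B ⟶ D} (w : f ≫ g = 0) :
    Abelian.image.ι f ≫ g = 0 := by
  rw [← cancel_epi (Abelian.factorThruImage f), ← Category.assoc, Abelian.image.fac, w, comp_zero]

lemma isProjective_of_addOf {U : C} (h : addOf (isProjective C) U) : Projective U := by
  obtain ⟨m, X, hX, ⟨r⟩⟩ := h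
  have (i : Fin m) : Projective (X i) := hX i
  have : Projective (⨁ X) := by
    refine ⟨fun {E Y} f e _ => ?_⟩
    exact ⟨biproduct.desc fun i => Projective.factorThru (biproduct.ι X i ≫ f) e,
      biproduct.hom_ext' _ _ fun i => by simp⟩
  exact r.projective

namespace IsMinimalResolution

variable {M : C} {U : ChainComplex C ℕ} {π : U.X 0 ⟶ M}

lemma comp_factorThruImage (i : ℕ) : Abelian.image.ι (U.d (i + 2) (i + 1)) ≫
    Abelian.factorThruImage (U.d (i + 1) i) = 0 := by
  refine image_ι_comp_eq_zero ?_
  rw [← cancel_mono (Abelian.image.ι _), Category.assoc, Abelian.image.fac, U.d_comp_d, zero_comp]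

variable (h : IsMinimalResolution (isProjective C) U π)
include h

lemma projective_X : ∀ i, Projective (U.X i)
  | 0 => isProjective_of_addOf h.cover_zero.mem
  | i + 1 => isProjective_of_addOf (h.cover_succ i).mem

lemma hasProjectiveDimensionLT_iff_zero (k : ℕ) : HasProjectiveDimensionLT M (k + 2) ↔
    HasProjectiveDimensionLT (Abelian.image (U.d 1 0)) (k + 1) := by
  have := h.cover_zero.admissible.1
  exact (shortExact_image_of_epi h.w h.exact_zero
    (image_ι_comp_eq_zero h.w)).hasProjectiveDimensionLT_X₃_iff k (h.projective_X 0)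

lemma shortExact (i : ℕ) : (ShortComplex.mk _ _ (comp_factorThruImage (U := U) i)).ShortExact := by
  have hex := h.exact_succ i
  rw [HomologicalComplex.exactAt_iff' _ (i + 2) (i + 1) i (by simp) (by simp)] at hex
  exact shortExact_image _ hex _

lemma hasProjectiveDimensionLT_iff_succ (i k : ℕ) :
    HasProjectiveDimensionLT (Abelian.image (U.d (i + 1) i)) (k + 2) ↔
    HasProjectiveDimensionLT (Abelian.image (U.d (i + 2) (i + 1))) (k + 1) :=
  (h.shortExact i).hasProjectiveDimensionLT_X₃_iff k (h.projective_X (i + 1))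

lemma hasProjectiveDimensionLT_iff (i k : ℕ) : HasProjectiveDimensionLT M (i + k + 2) ↔
    HasProjectiveDimensionLT (Abelian.image (U.d (i + 1) i)) (k + 1) := by
  induction i generalizing k with
  | zero => rw [zero_add, h.hasProjectiveDimensionLT_iff_zero]
  | succ i ih =>
    rw [← h.hasProjectiveDimensionLT_iff_succ i k, ← ih (k + 1)]
    rw [show i + 1 + k + 2 = i + (k + 1) + 2 by omega]

/-- Syzygies shift projective dimension. Were it less than `n`, the image in degree `n - 2` would be
projective, its cover an isomorphism, the next syzygy zero, and so `U.X n`, a cover of it, zero. -/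
lemma projectiveDimension_eq {n : ℕ} (hn : 2 ≤ n) (h₁ : ¬ IsZero (U.X n))
    (h₂ : IsZero (U.X (n + 1))) : projectiveDimension M = (n : ℕ) := by
  obtain ⟨m, rfl⟩ := Nat.exists_eq_add_of_le' hn
  refine le_antisymm ?_ ?_
  · rw [projectiveDimension_le_iff]
    have h3 : IsZero (Abelian.image (U.d (m + 2 + 1) (m + 2))) :=
      IsZero.of_epi (Abelian.factorThruImage (U.d (m + 2 + 1) (m + 2))) h₂
    have := h.projective_X (m + 2)
    exact (h.hasProjectiveDimensionLT_iff (m + 1) 0).2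
      ((h.shortExact (m + 1)).hasProjectiveDimensionLT_X₃ 0 h3.hasProjectiveDimensionLT_zero
        inferInstance)
  · rw [projectiveDimension_ge_iff]
    intro h3
    have h4 : Projective (Abelian.image (U.d (m + 1) m)) :=
      projective_iff_hasProjectiveDimensionLT_one.2 ((h.hasProjectiveDimensionLT_iff m 0).1 h3)
    have := isIso_of_isCover (h.cover_succ m)
    apply h₁
    refine isZero_of_isCover (h.cover_succ (m + 1)) ?_
    refine IsZero.of_mono_eq_zero (Abelian.image.ι (U.d (m + 2) (m + 1))) ?_
    rw [← cancel_mono (Abelian.factorThruImage (U.d (m + 1) m)), comp_factorThruImage, zero_comp]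

end IsMinimalResolution

end MinimalResolutions

/-! ### Simple tops and minimality of Hom(U, G) over the endomorphism ring. -/

section HomModules

variable {C : Type u} [Category.{v} C] [Abelian C]

/-- Precomposition as a morphism of modules over the endomorphism ring. -/
def precomp (G : C) {X Y : C} (f : X ⟶ Y) : (Y ⟶ G) →ₗ[End G] (X ⟶ G) where
  toFun g := f ≫ g
  map_add' _ _ := Preadditive.comp_add _ _ _ _ _ _
  map_smul' _ _ := (Category.assoc _ _ _).symm

lemma precomp_apply (G : C) {X Y : C} (f : X ⟶ Y) (g : Y ⟶ G) : precomp G f g = f ≫ g := rfl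

/-- Precomposition turns the retract into a direct summand of the regular module. -/
lemma projective_homModule {X G : C} (r : Retract X G) : Module.Projective (End G) (X ⟶ G) := by
  have : (precomp G r.i).comp (precomp G r.r) = LinearMap.id := by
    ext f
    change r.i ≫ r.r ≫ f = f
    rw [r.retract_assoc]
  have hG : Module.Projective (End G) (G ⟶ G) :=
    show Module.Projective (End G) (End G) from inferInstance
  exact Module.Projective.of_split (M := (G ⟶ G)) (precomp G r.r) (precomp G r.i) this

/-- An endomorphism of the `End G`-module `Hom(X, G)`, for a retract `X` of `G`, is the identity if
it fixes the inclusion of `X` up to a morphism annihilated by the retraction. -/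
lemma linearMap_apply_eq_of_retract {X G : C} (r : Retract X G)
    (φ : (X ⟶ G) →ₗ[End G] (X ⟶ G)) (h : (φ r.i - r.i) ≫ r.r = 0) (f : X ⟶ G) : φ f = f := by
  -- The inclusion `r.i` generates the module, so linearity reduces everything to its image.
  have hf : f = (show End G from r.r ≫ f) • r.i := (r.retract_assoc f).symm
  have h1 : φ f - f = (φ r.i - r.i) ≫ r.r ≫ f := by
    conv_lhs => rw [hf, map_smul, ← smul_sub]
    rfl
  rw [← sub_eq_zero, h1, ← Category.assoc, h, zero_comp]

variable (G : C) (U : CochainComplex C ℕ)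

/-- The hypotheses under which `Hom(U, G)` is a minimal projective resolution of the simple top of
`Hom(U^0, G)`. -/
structure IsDualResolution : Prop where
  factor : ∀ p (f : U.X (p + 1) ⟶ G), U.d p (p + 1) ≫ f = 0 →
    ∃ g, U.d (p + 1) (p + 2) ≫ g = f
  retract : ∀ p, Nonempty (Retract (U.X p) G)
  hom_eq_zero : ∀ p (f : U.X (p + 1) ⟶ U.X p), f = 0
  local_zero : ∀ f : U.X 0 ⟶ G, (∃ g, f ≫ g = 𝟙 _) ∨ ∃ g, U.d 0 1 ≫ g = f
  ne_zero : ¬ IsZero (U.X 0)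

variable {G U}

namespace IsDualResolution

variable (h : IsDualResolution G U)
include h

variable {X : C} (e : X ≅ U.X 0)

/-- If a split monomorphism factored through U^0 → U^1, the identity would involve a morphism U^1 →
U^0, and these vanish. -/
lemma not_mem_range {f : X ⟶ G} {g : G ⟶ X} (hf : f ≫ g = 𝟙 X) :
    f ∉ LinearMap.range (precomp G (e.hom ≫ U.d 0 1)) := by
  rintro ⟨k, rfl⟩
  rw [precomp_apply, Category.assoc, Category.assoc] at hf
  have h1 := h.hom_eq_zero 0 (k ≫ g ≫ e.hom)
  apply h.ne_zero
  have h2 : 𝟙 X = 0 := by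
    rw [← cancel_mono e.hom, ← hf, Category.assoc, Category.assoc, Category.assoc, h1, comp_zero,
      comp_zero, zero_comp]
  exact (IsZero.iff_id_eq_zero X).2 h2 |>.of_iso e.symm

lemma split_of_notMem {f : X ⟶ G} (hf : f ∉ LinearMap.range (precomp G (e.hom ≫ U.d 0 1))) :
    ∃ g, f ≫ g = 𝟙 X := by
  obtain ⟨g, hg⟩ | ⟨g, hg⟩ := h.local_zero (e.inv ≫ f)
  · refine ⟨g ≫ e.inv, ?_⟩
    rw [← cancel_epi e.inv, ← Category.assoc, ← Category.assoc, hg]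
    simp
  · refine absurd ⟨g, ?_⟩ hf
    rw [precomp_apply, Category.assoc, hg, e.hom_inv_id_assoc]

/-- Such an `f` is a split monomorphism, and any `k` equals `f` followed by the endomorphism `g ≫ k`
of `G`. -/
lemma span_eq_top {f : X ⟶ G} (hf : f ∉ LinearMap.range (precomp G (e.hom ≫ U.d 0 1)))
    {N : Submodule (End G) (X ⟶ G)} (hN : f ∈ N) : N = ⊤ := by
  obtain ⟨g, hg⟩ := h.split_of_notMem e hf
  refine eq_top_iff.2 fun k _ => ?_
  have : k = (show End G from g ≫ k) • f := by
    change k = f ≫ g ≫ k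
    rw [← Category.assoc, hg, Category.id_comp]
  rw [this]
  exact N.smul_mem _ hN

include e in
lemma exists_split : ∃ (f : X ⟶ G) (g : G ⟶ X), f ≫ g = 𝟙 X := by
  obtain ⟨r⟩ := h.retract 0
  exact ⟨e.hom ≫ r.i, r.r ≫ e.inv, by simp⟩

lemma isCoatom_range : IsCoatom (LinearMap.range (precomp G (e.hom ≫ U.d 0 1))) := by
  refine ⟨fun htop => ?_, fun N hN => ?_⟩
  · obtain ⟨f, g, hf⟩ := h.exists_split e
    exact h.not_mem_range e hf (htop ▸ Submodule.mem_top)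
  · obtain ⟨f, hfN, hf⟩ := Set.exists_of_ssubset hN
    exact h.span_eq_top e hf hfN

/-- Every element outside the range generates the module, so a maximal submodule lies in the range
and then equals it: the range is the only maximal submodule. -/
lemma range_eq_jacobson :
    LinearMap.range (precomp G (e.hom ≫ U.d 0 1)) = Module.jacobson (End G) (X ⟶ G) := by
  refine le_antisymm (le_sInf fun N hN => ?_) (sInf_le (h.isCoatom_range e))
  have hN' : N ≤ LinearMap.range (precomp G (e.hom ≫ U.d 0 1)) := by
    intro f hf
    by_contra hf'
    exact hN.1 (h.span_eq_top e hf' hf)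
  by_contra hle
  exact (h.isCoatom_range e).1 (hN.2 _ (lt_of_le_not_ge hN' hle))

include e in
lemma isSimpleModule_top : IsSimpleModule (End G) (topHomModule X G) := by
  have := h.isCoatom_range e
  rw [h.range_eq_jacobson e] at this
  exact isSimpleModule_iff_isCoatom.2 this

/-- The augmentation of the complex `Hom(U, G)`. -/
def augmentation (_ : IsDualResolution G U) (e : X ≅ U.X 0) :
    (homComplex U G).X 0 ⟶ topHomModule X G :=
  ModuleCat.ofHom ((Submodule.mkQ (Module.jacobson (End G) (X ⟶ G))).comp (precomp G e.hom))

lemma augmentation_apply (f : U.X 0 ⟶ G) :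
    (h.augmentation e).hom f = Submodule.Quotient.mk (e.hom ≫ f) := rfl

lemma augmentation_eq_zero_iff (f : U.X 0 ⟶ G) :
    (h.augmentation e).hom f = 0 ↔ ∃ g, U.d 0 1 ≫ g = f := by
  rw [augmentation_apply, Submodule.Quotient.mk_eq_zero, ← h.range_eq_jacobson e]
  constructor
  · rintro ⟨g, hg⟩
    refine ⟨g, ?_⟩
    rwa [precomp_apply, Category.assoc, cancel_epi] at hg
  · rintro ⟨g, rfl⟩
    exact ⟨g, Category.assoc _ _ _⟩

lemma projective_homComplex (p : ℕ) : Projective ((homComplex U G).X p) := by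
  refine (IsProjective.iff_projective (R := End G) (U.X p ⟶ G)).1 ?_
  obtain ⟨r⟩ := h.retract p
  exact projective_homModule r

lemma addOf_homComplex (p : ℕ) : addOf (isProjective _) ((homComplex U G).X p) :=
  addOf_of_mem (h.projective_homComplex p)

lemma epi_augmentation : Epi (h.augmentation e) := by
  rw [ModuleCat.epi_iff_surjective]
  intro x
  obtain ⟨f, rfl⟩ := Submodule.Quotient.mk_surjective _ x
  refine ⟨e.inv ≫ f, ?_⟩
  change Submodule.Quotient.mk (e.hom ≫ e.inv ≫ f) = _
  rw [e.hom_inv_id_assoc]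

/-- Endomorphisms of the terms of `Hom(U, G)` that are the identity modulo boundaries. -/
lemma isIso_of_sub_mem (p : ℕ) (g : (homComplex U G).X p ⟶ (homComplex U G).X p)
    (hg : ∀ f : U.X p ⟶ G, ∃ k : U.X (p + 1) ⟶ G,
      U.d p (p + 1) ≫ k = (show U.X p ⟶ G from g.hom f) - f) : IsIso g := by
  have : g = 𝟙 _ := by
    refine ModuleCat.hom_ext (LinearMap.ext fun f => ?_)
    obtain ⟨r⟩ := h.retract p
    refine linearMap_apply_eq_of_retract r g.hom ?_ f
    -- The deviation from the identity on the generator is a boundary `U.d p (p + 1) ≫ k`; after the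
    -- retraction it contains a morphism U^(p+1) → U^p, which is zero.
    obtain ⟨k, hk⟩ := hg r.i
    refine (congrArg (fun t => t ≫ r.r) hk).symm.trans ?_
    rw [Category.assoc, h.hom_eq_zero p (k ≫ r.r), comp_zero]
  rw [this]
  infer_instance

/-- An endomorphism compatible with one of the surjections is the identity modulo boundaries, by
exactness, hence is the identity. Admissibility is automatic since the test objects are projective.
-/
theorem isMinimalResolution :
    IsMinimalResolution (isProjective _) (homComplex U G) (h.augmentation e) where
  w := by
    refine ModuleCat.hom_ext (LinearMap.ext fun f => ?_)
    exact (h.augmentation_eq_zero_iff e _).2 ⟨f, rfl⟩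
  exact_zero := by
    rw [ShortComplex.moduleCat_exact_iff]
    intro f hf
    exact (h.augmentation_eq_zero_iff e f).1 hf
  exact_succ i := by
    rw [HomologicalComplex.exactAt_iff' _ (i + 2) (i + 1) i (by simp) (by simp),
      ShortComplex.moduleCat_exact_iff]
    intro f hf
    exact h.factor i f hf
  cover_zero :=
    { mem := h.addOf_homComplex 0
      admissible := by
        have := h.epi_augmentation e
        exact ⟨this, fun X (hX : Projective X) k =>
          ⟨Projective.factorThru k _, Projective.factorThru_comp _ _⟩⟩
      minimal := fun g hg => h.isIso_of_sub_mem 0 g fun f => by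
        refine (h.augmentation_eq_zero_iff e _).1 ?_
        refine (map_sub (h.augmentation e).hom _ _).trans (sub_eq_zero.2 ?_)
        exact congrArg (fun t => t.hom f) hg }
  cover_succ i :=
    { mem := h.addOf_homComplex (i + 1)
      admissible := ⟨inferInstance, fun X (hX : Projective X) k =>
          ⟨Projective.factorThru k _, Projective.factorThru_comp _ _⟩⟩
      minimal := fun g hg => h.isIso_of_sub_mem (i + 1) g fun f => by
        have hg' : g ≫ (homComplex U G).d (i + 1) i = (homComplex U G).d (i + 1) i := by
          rw [← Abelian.image.fac ((homComplex U G).d (i + 1) i), ← Category.assoc, hg]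
        refine h.factor i _ ?_
        have := congrArg (fun t => t.hom f) hg'
        rw [Preadditive.comp_sub, sub_eq_zero]
        exact this }

end IsDualResolution

end HomModules

section HomModules

variable {C : Type u} [Category.{v} C] [Abelian C] {G : C} {U : CochainComplex C ℕ}

lemma IsDualResolution.isZero_homComplex_iff (h : IsDualResolution G U) (p : ℕ) :
    IsZero ((homComplex U G).X p) ↔ IsZero (U.X p) := by
  rw [ModuleCat.isZero_iff_subsingleton]
  constructor
  · intro hs
    obtain ⟨r⟩ := h.retract p
    have h0 : r.i = 0 := hs.elim (show (homComplex U G).X p from r.i) _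
    rw [IsZero.iff_id_eq_zero, ← r.retract, h0, zero_comp]
  · exact fun h0 => ⟨fun a b => h0.eq_of_src (show U.X p ⟶ G from a) b⟩

end HomModules

/-! ### The direct sum `G` and its summands. -/

section SumOf

variable {K : Type u} [Field K] {P : Type} [PartialOrder P] [Finite P] {F : Set (Spread P)}

/-- The inclusion of a summand. -/
def sumι {S : Spread P} (hS : S ∈ F) : spreadModule K S ⟶ sumOf K F :=
  biproduct.ι (fun S : F => spreadModule K S.1) ⟨S, hS⟩

/-- The projection to a summand. -/
def sumπ {S : Spread P} (hS : S ∈ F) : sumOf K F ⟶ spreadModule K S :=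
  biproduct.π (fun S : F => spreadModule K S.1) ⟨S, hS⟩

lemma sumι_π_self {S : Spread P} (hS : S ∈ F) : sumι hS ≫ sumπ hS = 𝟙 (spreadModule K S) :=
  biproduct.ι_π_self (fun S : F => spreadModule K S.1) ⟨S, hS⟩

lemma sumι_π_ne {S T : Spread P} (hS : S ∈ F) (hT : T ∈ F) (h : S ≠ T) :
    (sumι hS ≫ sumπ hT : spreadModule K S ⟶ spreadModule K T) = 0 :=
  biproduct.ι_π_ne (fun S : F => spreadModule K S.1) fun h' => h (congrArg Subtype.val h')

lemma exists_lift {A : PersMod K P} (g : ∀ (T : Spread P) (_ : T ∈ F), A ⟶ spreadModule K T) :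
    ∃ f : A ⟶ sumOf K F, ∀ (T : Spread P) (hT : T ∈ F), f ≫ sumπ hT = g T hT :=
  ⟨biproduct.lift fun T : F => g T.1 T.2, fun T hT =>
    biproduct.lift_π (fun T : F => g T.1 T.2) ⟨T, hT⟩⟩

lemma sumOf_hom_ext {A : PersMod K P} {f g : A ⟶ sumOf K F}
    (h : ∀ (T : Spread P) (hT : T ∈ F), f ≫ sumπ hT = g ≫ sumπ hT) : f = g :=
  biproduct.hom_ext f g fun T => h T.1 T.2

end SumOf

/-! ### The Koszul-type complex satisfies the hypotheses of a dual resolution. -/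

section Koszul

variable {n : ℕ} {K : Type u} [Field K] (hn : 1 < n)

lemma spreadModule_not_isZero {P : Type} [PartialOrder P] (S : Spread P) :
    ¬ IsZero (spreadModule K S) := by
  rw [IsZero.iff_id_eq_zero]
  intro h
  obtain ⟨x, hx⟩ := S.nonempty
  exact one_ne_zero ((homVal_id (K := K) hx).symm.trans ((congrArg _ h).trans (map_zero _)))

lemma koszulX_not_isZero {p : ℕ} (hp : p ≤ n) : ¬ IsZero (koszulX K hn p) := by
  obtain ⟨B, -, hB⟩ := Finset.exists_subset_card_eq (s := (Finset.univ : Finset (Fin n)))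
    (n := p) (by simpa using hp)
  intro h
  apply spreadModule_not_isZero (K := K) (koszulSpread hn B)
  have := biproduct.ι_π_self (fun B' : {B' : Finset (Fin n) // B'.card = p} =>
    spreadModule K (koszulSpread hn B'.1)) ⟨B, hB⟩
  rw [IsZero.iff_id_eq_zero, ← this, h.eq_of_tgt (biproduct.ι _ _) 0, zero_comp]

/-- The isomorphism between the module of the largest spread and `U^0`. -/
def koszulXZeroIso : spreadModule K (koszulSpread hn ∅) ≅ koszulX K hn 0 where
  hom := biproduct.ι (fun B' : {B' : Finset (Fin n) // B'.card = 0} =>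
    spreadModule K (koszulSpread hn B'.1)) ⟨∅, Finset.card_empty⟩
  inv := biproduct.π (fun B' : {B' : Finset (Fin n) // B'.card = 0} =>
    spreadModule K (koszulSpread hn B'.1)) ⟨∅, Finset.card_empty⟩
  hom_inv_id := biproduct.ι_π_self _ _
  inv_hom_id := by
    refine biproduct.hom_ext' _ _ fun B => ?_
    obtain rfl : B = ⟨∅, Finset.card_empty⟩ := Subtype.ext (Finset.card_eq_zero.1 B.2)
    rw [biproduct.ι_π_self_assoc, Category.comp_id]

lemma exists_factor_sumOf {p : ℕ} {F : Set (Spread (Grid n))}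
    (f : koszulX K hn p ⟶ sumOf K F)
    (h : ∀ T (hT : T ∈ F), ∃ g, koszulD K hn p ≫ g = f ≫ sumπ hT) :
    ∃ g, koszulD K hn p ≫ g = f := by
  choose g hg using h
  obtain ⟨g', hg'⟩ := exists_lift g
  exact ⟨g', sumOf_hom_ext fun T hT => by rw [Category.assoc, hg', hg]⟩

variable {F : Set (Spread (Grid n))} (hF : ∀ B, koszulSpread hn B ∈ F)

/-- The module `U^p` is a direct summand of the sum of all spread modules. -/
def koszulXRetract (p : ℕ) : Retract (koszulX K hn p) (sumOf K F) where
  i := biproduct.desc fun B => sumι (hF B.1)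
  r := biproduct.lift fun B => sumπ (hF B.1)
  retract := by
    refine biproduct.hom_ext' _ _ fun B => biproduct.hom_ext _ _ fun B' => ?_
    simp only [Category.assoc, biproduct.ι_desc_assoc, biproduct.lift_π, Category.comp_id]
    by_cases h : B = B'
    · subst h
      rw [biproduct.ι_π_self, sumι_π_self]
    · rw [biproduct.ι_π_ne _ h, sumι_π_ne]
      exact fun h' => h (Subtype.ext (koszulSpread_injective hn h'))

include hF in
-- The component of `f` at the summand `I_S` of `G` is a scalar `c`. If `c ≠ 0`, rescaling the
-- projection splits `f`; if `c = 0`, every component factors through the differential, the others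
-- by acyclicity for `T ≠ S`.
lemma koszul_local_zero (f : koszulX K hn 0 ⟶ sumOf K F) :
    (∃ g, f ≫ g = 𝟙 _) ∨ ∃ g, koszulD K hn 0 ≫ g = f := by
  let t : spreadModule K (koszulSpread hn ∅) ⟶ spreadModule K (koszulSpread hn ∅) :=
    (koszulXZeroIso hn).hom ≫ f ≫ sumπ (hF ∅)
  let c : K := homVal (corner_mem_koszulSpread hn ∅) _ t
  have ht : t = c • 𝟙 _ := koszul_homVal_injective hn _ _ (by
    rw [homVal_smul, homVal_id, mul_one])
  have hf : f ≫ sumπ (hF ∅) = c • (koszulXZeroIso hn).inv := by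
    rw [← cancel_epi (koszulXZeroIso (K := K) hn).hom]
    refine Eq.trans ht ?_
    rw [Linear.comp_smul, Iso.hom_inv_id]
  by_cases hc : c = 0
  · refine Or.inr (exists_factor_sumOf hn f fun T hT => ?_)
    by_cases h : T = koszulSpread hn ∅
    · subst h
      exact ⟨0, by rw [hf, hc, zero_smul, comp_zero]⟩
    · exact exists_factor_zero hn h _
  · refine Or.inl ⟨sumπ (hF ∅) ≫ (c⁻¹ • (koszulXZeroIso hn).hom), ?_⟩
    rw [← Category.assoc, hf, Linear.smul_comp, Linear.comp_smul, smul_smul,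
      mul_inv_cancel₀ hc, one_smul, Iso.inv_hom_id]

lemma exists_factor_succ_sumOf {p : ℕ} (f : koszulX K hn (p + 1) ⟶ sumOf K F)
    (hf : koszulD K hn p ≫ f = 0) : ∃ g, koszulD K hn (p + 1) ≫ g = f :=
  exists_factor_sumOf hn f fun T hT => exists_factor_succ hn _ (by
    rw [← Category.assoc, hf, zero_comp])

include hF in
theorem koszulComplex_isDualResolution :
    IsDualResolution (sumOf K F) (koszulComplex K hn) where
  factor p f hf := by
    rw [koszulComplex_d] at hf ⊢
    exact exists_factor_succ_sumOf hn f hf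
  retract p := ⟨koszulXRetract hn hF p⟩
  hom_eq_zero p f := koszulX_hom_eq_zero hn f
  local_zero f := by
    rw [koszulComplex_d]
    exact koszul_local_zero hn hF f
  ne_zero := koszulX_not_isZero hn (Nat.zero_le n)

end Koszul

/-! ### Resolutions from iterated covers, and dimension shifting. -/

section RelativeResolutions

variable {C : Type u} [Category.{v} C] [Abelian C] {𝒳 : ObjectProperty C}

lemma IsAdmissibleEpi.exists_lift {A B : C} {f : A ⟶ B} (hf : IsAdmissibleEpi 𝒳 f) {V : C}
    (hV : addOf 𝒳 V) (h : V ⟶ B) : ∃ g, g ≫ f = h := by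
  obtain ⟨m, X, hX, ⟨r⟩⟩ := hV
  choose g hg using fun i => hf.2 (X i) (hX i) (biproduct.ι X i ≫ r.r ≫ h)
  refine ⟨r.i ≫ biproduct.desc g, ?_⟩
  have : biproduct.desc g ≫ f = r.r ≫ h := biproduct.hom_ext' _ _ fun i => by
    rw [biproduct.ι_desc_assoc, hg]
  rw [Category.assoc, this, r.retract_assoc]

lemma IsCover.comp_iso {U M N : C} {f : U ⟶ M} (hf : IsCover 𝒳 f) (e : M ⟶ N) [IsIso e] :
    IsCover 𝒳 (f ≫ e) where
  mem := hf.mem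
  admissible := by
    have := hf.admissible.1
    refine ⟨epi_comp _ _, fun X hX h => ?_⟩
    obtain ⟨g, hg⟩ := hf.admissible.2 X hX (h ≫ inv e)
    exact ⟨g, by rw [← Category.assoc, hg, Category.assoc, IsIso.inv_hom_id, Category.comp_id]⟩
  minimal g hg := hf.minimal g (by rwa [← Category.assoc, cancel_mono] at hg)

/-- As `f` is epi and `j` mono, the image of `f ≫ j` is `M` itself. -/
lemma IsCover.factorThruImage {U M N : C} {f : U ⟶ M} (hf : IsCover 𝒳 f) (j : M ⟶ N) [Mono j] :
    IsCover 𝒳 (Abelian.factorThruImage (f ≫ j)) := by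
  have := hf.admissible.1
  have hj : j ≫ cokernel.π (f ≫ j) = 0 := by
    rw [← cancel_epi f, ← Category.assoc, cokernel.condition, comp_zero]
  let t : M ⟶ Abelian.image (f ≫ j) := kernel.lift _ j hj
  have ht : t ≫ Abelian.image.ι (f ≫ j) = j := kernel.lift_ι _ _ _
  have h : f ≫ t = Abelian.factorThruImage (f ≫ j) := by
    rw [← cancel_mono (Abelian.image.ι (f ≫ j)), Category.assoc, ht, Abelian.image.fac]
  have h1 : Mono (t ≫ Abelian.image.ι (f ≫ j)) := by rw [ht]; infer_instance
  have : Mono t := mono_of_mono t (Abelian.image.ι (f ≫ j))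
  have h2 : Epi (f ≫ t) := by rw [h]; infer_instance
  have : Epi t := epi_of_epi f t
  have : IsIso t := isIso_of_mono_of_epi t
  rw [← h]
  exact hf.comp_iso t

/-- Covers of successive kernels. -/
structure CoverTower (𝒳 : ObjectProperty C) where
  syz : ℕ → C
  X : ℕ → C
  f : ∀ i, X i ⟶ syz i
  cover : ∀ i, IsCover 𝒳 (f i)
  j : ∀ i, syz (i + 1) ⟶ X i
  mono : ∀ i, Mono (j i)
  w : ∀ i, j i ≫ f i = 0
  exact : ∀ i, (ShortComplex.mk _ _ (w i)).Exact

namespace CoverTower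

variable (t : CoverTower 𝒳)

lemma epi (i : ℕ) : Epi (t.f i) := (t.cover i).admissible.1

/-- The resolution given by covers of successive kernels. -/
def complex : ChainComplex C ℕ :=
  ChainComplex.of t.X (fun i => t.f (i + 1) ≫ t.j i) fun i => by
    rw [Category.assoc, ← Category.assoc (t.j (i + 1)), t.w, zero_comp, comp_zero]

lemma complex_d (i : ℕ) : t.complex.d (i + 1) i = t.f (i + 1) ≫ t.j i :=
  ChainComplex.of_d t.X (fun i => t.f (i + 1) ≫ t.j i) i

lemma exact_comp (i : ℕ) (w : (t.f (i + 1) ≫ t.j i) ≫ t.f i = 0) :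
    (ShortComplex.mk _ _ w).Exact := by
  have := t.epi (i + 1)
  exact (ShortComplex.exact_iff_of_epi_of_isIso_of_mono (S₁ := ShortComplex.mk _ _ w)
    (S₂ := ShortComplex.mk _ _ (t.w i))
    { τ₁ := t.f (i + 1), τ₂ := 𝟙 _, τ₃ := 𝟙 _ }).2 (t.exact i)

lemma exact_comp_comp (i : ℕ)
    (w : (t.f (i + 2) ≫ t.j (i + 1)) ≫ t.f (i + 1) ≫ t.j i = 0) :
    (ShortComplex.mk _ _ w).Exact := by
  have := t.mono i
  have w' : (t.f (i + 2) ≫ t.j (i + 1)) ≫ t.f (i + 1) = 0 := by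
    rw [Category.assoc, t.w, comp_zero]
  exact (ShortComplex.exact_iff_of_epi_of_isIso_of_mono (S₁ := ShortComplex.mk _ _ w')
    (S₂ := ShortComplex.mk _ _ w)
    { τ₁ := 𝟙 _, τ₂ := 𝟙 _, τ₃ := t.j i }).1 (t.exact_comp (i + 1) w')

theorem isMinimalResolution : IsMinimalResolution 𝒳 t.complex (t.f 0) := by
  have w : t.complex.d 1 0 ≫ t.f 0 = 0 := by
    rw [complex_d]
    exact (Category.assoc _ _ _).trans ((congrArg (fun s => t.f 1 ≫ s) (t.w 0)).trans comp_zero)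
  refine ⟨w, ?_, fun i => ?_, t.cover 0, fun i => ?_⟩
  · generalize_proofs
    revert w
    rw [complex_d]
    exact fun w => t.exact_comp 0 w
  · rw [HomologicalComplex.exactAt_iff' _ (i + 2) (i + 1) i (by simp) (by simp)]
    have w' := t.complex.d_comp_d (i + 2) (i + 1) i
    change (ShortComplex.mk (t.complex.d (i + 2) (i + 1)) (t.complex.d (i + 1) i) w').Exact
    revert w'
    rw [complex_d, complex_d]
    exact fun w => t.exact_comp_comp i w
  · rw [complex_d]
    have := t.mono i
    exact (t.cover (i + 1)).factorThruImage (t.j i)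

end CoverTower

section Existence

variable {𝒜 : ObjectProperty C}
  (hcov : ∀ M, 𝒜 M → ∃ (U : C) (f : U ⟶ M), IsCover 𝒳 f ∧ 𝒜 (kernel f))

/-- The iterated kernels of covers. -/
def iteratedSyzygy (M : C) (hM : 𝒜 M) : ℕ → {M // 𝒜 M}
  | 0 => ⟨M, hM⟩
  | i + 1 => ⟨kernel (hcov _ (iteratedSyzygy M hM i).2).choose_spec.choose,
      (hcov _ (iteratedSyzygy M hM i).2).choose_spec.choose_spec.2⟩

/-- The tower of covers of an object of a class closed under kernels of covers. -/
def coverTower (M : C) (hM : 𝒜 M) : CoverTower 𝒳 where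
  syz i := (iteratedSyzygy hcov M hM i).1
  X i := (hcov _ (iteratedSyzygy hcov M hM i).2).choose
  f i := (hcov _ (iteratedSyzygy hcov M hM i).2).choose_spec.choose
  cover i := (hcov _ (iteratedSyzygy hcov M hM i).2).choose_spec.choose_spec.1
  j _ := kernel.ι _
  mono _ := inferInstanceAs (Mono (kernel.ι _))
  w _ := kernel.condition _
  exact _ := ShortComplex.exact_kernel _

end Existence

/-- The complex `Hom(V, A)` is exact in degree `q`. -/
def HomExactAt (V : CochainComplex C ℕ) (A : C) (q : ℕ) : Prop :=
  -- In degree 0 the hypothesis is vacuous, so every morphism must factor through the first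
  -- differential.
  ∀ f : V.X q ⟶ A, (∀ p, V.d p q ≫ f = 0) → ∃ g, V.d q (q + 1) ≫ g = f

variable {V : CochainComplex C ℕ} {q : ℕ}

lemma HomExactAt.retract {A B : C} (r : Retract A B) (h : HomExactAt V B q) :
    HomExactAt V A q := fun f hf => by
  obtain ⟨g, hg⟩ := h (f ≫ r.i) fun p => by rw [← Category.assoc, hf, zero_comp]
  exact ⟨g ≫ r.r, by rw [← Category.assoc, hg, Category.assoc, r.retract, Category.comp_id]⟩

lemma HomExactAt.biproduct {m : ℕ} {X : Fin m → C} (h : ∀ i, HomExactAt V (X i) q) :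
    HomExactAt V (⨁ X) q := fun f hf => by
  choose g hg using fun i => h i (f ≫ biproduct.π X i) fun p => by
    rw [← Category.assoc, hf, zero_comp]
  exact ⟨biproduct.lift g, biproduct.hom_ext _ _ fun i => by
    rw [Category.assoc, biproduct.lift_π, hg]⟩

lemma HomExactAt.of_addOf (h : ∀ X, 𝒳 X → HomExactAt V X q) {A : C} (hA : addOf 𝒳 A) :
    HomExactAt V A q := by
  obtain ⟨m, X, hX, ⟨r⟩⟩ := hA
  exact (HomExactAt.biproduct fun i => h _ (hX i)).retract r

lemma HomExactAt.of_isZero {A : C} (hA : IsZero A) : HomExactAt V A q :=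
  fun _ _ => ⟨0, hA.eq_of_tgt _ _⟩

/-- Dimension shift along an admissible short exact sequence. -/
lemma HomExactAt.succ {A B D : C} {j : A ⟶ B} {f : B ⟶ D} [Mono j] (w : j ≫ f = 0)
    (hex : (ShortComplex.mk j f w).Exact) (hf : IsAdmissibleEpi 𝒳 f)
    (hV : addOf 𝒳 (V.X (q + 1))) (hB : HomExactAt V B (q + 1)) (hA : HomExactAt V A q) :
    HomExactAt V D (q + 1) := by
  intro φ hφ
  obtain ⟨φ', rfl⟩ := hf.exists_lift hV φ
  -- The connecting construction: the coboundary of the lift `φ'` lands in `A`. Exactness at `A`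
  -- writes it as the coboundary of `ψ`, and `φ' - ψ ≫ j` is then a cocycle in `B` that still lifts
  -- `φ`.
  let ξ : V.X q ⟶ A := hex.lift (V.d q (q + 1) ≫ φ') ((Category.assoc _ _ _).trans (hφ q))
  have hξ : ξ ≫ j = V.d q (q + 1) ≫ φ' := hex.lift_f _ _
  obtain ⟨ψ, hψ⟩ := hA ξ fun p => by
    rw [← cancel_mono j, Category.assoc, hξ, ← Category.assoc, V.d_comp_d, zero_comp, zero_comp]
  obtain ⟨χ, hχ⟩ := hB (φ' - ψ ≫ j) fun p => by
    by_cases hp : p + 1 = q + 1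
    · obtain rfl : p = q := by omega
      rw [Preadditive.comp_sub, ← Category.assoc, hψ, hξ, sub_self]
    · rw [V.shape p (q + 1) (by simpa using hp), zero_comp]
  refine ⟨χ ≫ f, ?_⟩
  rw [← Category.assoc, hχ, Preadditive.sub_comp, Category.assoc, w, comp_zero, sub_zero]

/-- If the resolution given by a tower of covers ends after degree `l`, then `Hom(V, -)` of the
resolved object is exact in degrees greater than `l`. -/
lemma CoverTower.homExactAt (t : CoverTower 𝒳) (hV : ∀ q, addOf 𝒳 (V.X q))
    (h : ∀ q X, 𝒳 X → HomExactAt V X (q + 1)) {l : ℕ} (hl : IsZero (t.X (l + 1))) (i : ℕ)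
    (hi : i ≤ l + 1) (q : ℕ) : HomExactAt V (t.syz (l + 1 - i)) (i + q) := by
  -- Going down from the zero syzygy with index `l + 1`, where exactness holds in all degrees, each
  -- step costs one degree.
  induction i with
  | zero =>
    have := t.epi (l + 1)
    exact HomExactAt.of_isZero (IsZero.of_epi (t.f (l + 1)) hl)
  | succ i ih =>
    have ih := ih (by omega)
    rw [show l + 1 - i = (l + 1 - (i + 1)) + 1 by omega] at ih
    have := t.mono (l + 1 - (i + 1))
    rw [show i + 1 + q = i + q + 1 by omega]
    exact HomExactAt.succ (t.w _) (t.exact _) (t.cover _).admissible (hV _)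
      (HomExactAt.of_addOf (h _) (t.cover _).mem) ih

end RelativeResolutions

/-! ### Existence of covers for finite-dimensional representations. -/

section Covers

variable {K : Type u} [Field K] {P : Type} [PartialOrder P]

lemma injective_app {A B : PersMod K P} (f : A ⟶ B) [Mono f] (x : P) :
    Function.Injective (f.app x).hom :=
  (ModuleCat.mono_iff_injective _).1 inferInstance

lemma surjective_app {A B : PersMod K P} (f : A ⟶ B) [Epi f] (x : P) :
    Function.Surjective (f.app x).hom :=
  (ModuleCat.epi_iff_surjective _).1 inferInstance

lemma isIso_of_bijective {A B : PersMod K P} (f : A ⟶ B)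
    (h : ∀ x, Function.Bijective (f.app x).hom) : IsIso f := by
  have : ∀ x, IsIso (f.app x) := fun x => (ConcreteCategory.isIso_iff_bijective _).2 (h x)
  exact NatIso.isIso_of_isIso_app f

lemma pwfd_of_mono {A B : PersMod K P} (f : A ⟶ B) [Mono f] (hB : pwfd K P B) : pwfd K P A :=
  fun x => have := hB x; FiniteDimensional.of_injective _ (injective_app f x)

lemma pwfd_biproduct {ι : Type} [Finite ι] (X : ι → PersMod K P) (h : ∀ i, pwfd K P (X i)) :
    pwfd K P (⨁ X) := fun x => by
  have := fun i => h i x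
  have := Fintype.ofFinite ι
  refine FiniteDimensional.of_injective
    (LinearMap.pi fun i => ((biproduct.π X i).app x).hom) ?_
  refine (injective_iff_map_eq_zero _).2 fun a ha => ?_
  have h1 := congrArg (fun t => (t.app x).hom a) (biproduct.total : ∑ j, biproduct.π X j ≫ biproduct.ι X j = 𝟙 (⨁ X))
  have h2 : ∀ (s : Finset ι), ((∑ i ∈ s, biproduct.π X i ≫ biproduct.ι X i).app x).hom a = 0 := by
    intro s
    classical
    induction s using Finset.induction_on with
    | empty => rfl
    | insert i s hi ih =>
      rw [Finset.sum_insert hi]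
      have h3 : ((biproduct.π X i).app x).hom a = 0 := congrFun ha i
      have h4 : ((biproduct.π X i ≫ biproduct.ι X i).app x).hom a = 0 :=
        (congrArg ((biproduct.ι X i).app x).hom h3).trans (map_zero _)
      exact (congrArg₂ (· + ·) h4 ih).trans (add_zero _)
  exact h1.symm.trans (h2 _)

lemma pwfd_of_addOf {F : Set (Spread P)} {U : PersMod K P} (h : addOf (modulesOf K F) U) :
    pwfd K P U := by
  obtain ⟨m, X, hX, ⟨r⟩⟩ := h
  have : Mono r.i := inferInstance
  refine pwfd_of_mono r.i (pwfd_biproduct X fun i => ?_)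
  obtain ⟨S, -, ⟨e⟩⟩ := hX i
  exact pwfd_of_mono e.hom (spreadModule_pwfd S)

variable [Finite P]

lemma finiteDimensional_hom {A B : PersMod K P} (hA : pwfd K P A) (hB : pwfd K P B) :
    FiniteDimensional K (A ⟶ B) := by
  have (x : P) : FiniteDimensional K (A.obj x →ₗ[K] B.obj x) := by
    have := hA x
    have := hB x
    infer_instance
  let φ : (A ⟶ B) →ₗ[K] (∀ x, A.obj x →ₗ[K] B.obj x) :=
    { toFun := fun f x => (f.app x).hom
      map_add' := fun _ _ => rfl
      map_smul' := fun _ _ => rfl }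
  refine FiniteDimensional.of_injective φ fun f g h => ?_
  ext x : 2
  exact ModuleCat.hom_ext (congrFun h x)

/-- Each pointwise finite-dimensional representation has an admissible epimorphism from a finite
direct sum of spread modules. -/
lemma exists_admissibleEpi {F : Set (Spread P)} (hF : ∀ x, upSpread x ∈ F) {M : PersMod K P}
    (hM : pwfd K P M) : ∃ (U : PersMod K P) (f : U ⟶ M), addOf (modulesOf K F) U ∧
      IsAdmissibleEpi (modulesOf K F) f := by
  have hfin (S : F) : FiniteDimensional K (spreadModule K S.1 ⟶ M) :=
    finiteDimensional_hom (spreadModule_pwfd S.1) hM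
  -- One summand for each basis vector of each space of morphisms from a spread module to `M`.
  let ι : Type := Σ S : F, Fin (Module.finrank K (spreadModule K S.1 ⟶ M))
  let X : ι → PersMod K P := fun a => spreadModule K a.1.1
  let f : ⨁ X ⟶ M := biproduct.desc fun a => Module.finBasis K (spreadModule K a.1.1 ⟶ M) a.2
  have hf : ∀ (S : F) (h : spreadModule K S.1 ⟶ M), ∃ g, g ≫ f = h := by
    intro S h
    let b := Module.finBasis K (spreadModule K S.1 ⟶ M)
    refine ⟨∑ i, b.repr h i • biproduct.ι X ⟨S, i⟩, ?_⟩
    conv_rhs => rw [← b.sum_repr h]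
    rw [Preadditive.sum_comp]
    refine Finset.sum_congr rfl fun i _ => ?_
    rw [Linear.smul_comp, biproduct.ι_desc]
  refine ⟨⨁ X, f, addOf_biproduct X fun a => modulesOf_spreadModule a.1.2, ?_, ?_⟩
  · refine Preadditive.epi_of_cancel_zero _ fun {B} g hg => ?_
    -- The morphism `f` is epi because each component of the epimorphism `upCover` factors through
    -- it.
    have := upCover_epi M hM
    rw [← cancel_epi (upCover M hM), comp_zero]
    refine biproduct.hom_ext' _ _ fun a => ?_
    obtain ⟨k, hk⟩ := hf ⟨_, hF a.1⟩ (biproduct.ι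
      (fun a : BasisIndex M => spreadModule K (upSpread a.1)) a ≫ upCover M hM)
    rw [← Category.assoc, ← hk, Category.assoc, hg, comp_zero, comp_zero]
  · rintro Y ⟨S, hS, ⟨e⟩⟩ h
    obtain ⟨g, hg⟩ := hf ⟨S, hS⟩ (e.inv ≫ h)
    exact ⟨e.hom ≫ g, by rw [Category.assoc, hg, e.hom_inv_id_assoc]⟩

omit [Finite P] in
lemma pow_app {A : PersMod K P} (g : A ⟶ A) (N : ℕ) (x : P) :
    (((show End A from g) ^ N : End A).app x).hom = (g.app x).hom ^ N := by
  induction N with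
  | zero => rfl
  | succ N ih =>
    rw [pow_succ, pow_succ, ← ih]
    rfl

/-- Fitting's lemma at each of finitely many points gives a common exponent. It is nonzero so that
injectivity of the power implies injectivity of `g`. -/
lemma exists_pow_disjoint {A : PersMod K P} (hA : pwfd K P A) (g : A ⟶ A) :
    ∃ N, N ≠ 0 ∧ ∀ x, Disjoint (LinearMap.ker ((g.app x).hom ^ N))
      (LinearMap.range ((g.app x).hom ^ N)) := by
  have h : ∀ x, ∀ᶠ N in Filter.atTop, Disjoint (LinearMap.ker ((g.app x).hom ^ N))
      (LinearMap.range ((g.app x).hom ^ N)) := fun x => by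
    have := hA x
    exact Module.End.eventually_disjoint_ker_pow_range_pow (g.app x).hom
  obtain ⟨N, hN, hN'⟩ := ((Filter.eventually_all.2 h).and (Filter.eventually_ne_atTop 0)).exists
  exact ⟨N, hN', hN⟩

/-- The total dimension of a representation. -/
def totalDim (A : PersMod K P) : ℕ :=
  have := Fintype.ofFinite P
  ∑ x, Module.finrank K (A.obj x)

lemma totalDim_le_of_epi {A B : PersMod K P} (hA : pwfd K P A) (p : A ⟶ B) [Epi p] :
    totalDim B ≤ totalDim A := by
  refine Finset.sum_le_sum fun x _ => ?_
  have := hA x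
  exact LinearMap.finrank_le_finrank_of_surjective (surjective_app p x)

lemma isIso_of_epi_of_totalDim_le {A B : PersMod K P} (hA : pwfd K P A) (hB : pwfd K P B)
    (p : A ⟶ B) [Epi p] (h : totalDim A ≤ totalDim B) : IsIso p := by
  have hle (x : P) : Module.finrank K (B.obj x) ≤ Module.finrank K (A.obj x) := by
    have := hA x
    exact LinearMap.finrank_le_finrank_of_surjective (surjective_app p x)
  let := Fintype.ofFinite P
  have heq := (Finset.sum_eq_sum_iff_of_le fun x (_ : x ∈ Finset.univ) => hle x).1
    (le_antisymm (totalDim_le_of_epi hA p) h)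
  refine isIso_of_bijective p fun x => ⟨?_, surjective_app p x⟩
  have := hA x
  have := hB x
  exact (LinearMap.injective_iff_surjective_of_finrank_eq_finrank
    (heq x (Finset.mem_univ x)).symm).2 (surjective_app p x)

omit [Finite P] in
lemma comp_pow_eq {A M : PersMod K P} {g : A ⟶ A} {f : A ⟶ M} (h : g ≫ f = f) (N : ℕ) :
    (show A ⟶ A from (show End A from g) ^ N) ≫ f = f := by
  induction N with
  | zero => exact Category.id_comp f
  | succ N ih =>
    rw [pow_succ]
    change (g ≫ (show A ⟶ A from (show End A from g) ^ N)) ≫ f = f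
    rw [Category.assoc, ih, h]

/-- An admissible epimorphism of least total dimension is a cover. -/
lemma isCover_of_minimal {F : Set (Spread P)} {U M : PersMod K P} (f : U ⟶ M)
    (hU : addOf (modulesOf K F) U) (hf : IsAdmissibleEpi (modulesOf K F) f)
    (hmin : ∀ (W : PersMod K P) (f' : W ⟶ M), addOf (modulesOf K F) W →
      IsAdmissibleEpi (modulesOf K F) f' → totalDim U ≤ totalDim W) :
    IsCover (modulesOf K F) f := by
  refine ⟨hU, hf, fun g hg => ?_⟩
  have hUf := pwfd_of_addOf hU
  obtain ⟨N, hN0, hN⟩ := exists_pow_disjoint hUf g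
  -- The image of this power is a direct summand of `U`, and the restriction of `f` to it is still
  -- an admissible epimorphism. Minimality of the total dimension then makes the power injective.
  let e : U ⟶ U := (show End U from g) ^ N
  have he (x : P) : (e.app x).hom = (g.app x).hom ^ N := pow_app g N x
  let W := Abelian.image e
  let p : U ⟶ W := Abelian.factorThruImage e
  let i : W ⟶ U := Abelian.image.ι e
  have hpi : p ≫ i = e := Abelian.image.fac e
  have hW : pwfd K P W := pwfd_of_mono i hUf
  have hpix (x : P) (a : U.obj x) : (i.app x).hom ((p.app x).hom a) = (e.app x).hom a :=
    congrArg (fun t => (t.app x).hom a) hpi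
  have hinj (x : P) : Function.Injective ((i ≫ p).app x).hom := by
    refine (injective_iff_map_eq_zero _).2 fun w hw => ?_
    obtain ⟨a, rfl⟩ := surjective_app p x w
    have h1 : (e.app x).hom ((e.app x).hom a) = 0 := by
      rw [← hpix, ← hpix]
      exact (congrArg (i.app x).hom hw).trans (map_zero _)
    have h2 : (e.app x).hom a = 0 := by
      rw [he] at h1 ⊢
      exact (Submodule.disjoint_def.1 (hN x)) _ h1 ⟨a, rfl⟩
    refine injective_app i x ?_
    rw [hpix, h2, map_zero]
  have hip : IsIso (i ≫ p) := isIso_of_bijective _ fun x => by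
    have := hW x
    exact ⟨hinj x, LinearMap.injective_iff_surjective.1 (hinj x)⟩
  have r : Retract W U := ⟨i, p ≫ inv (i ≫ p), by rw [← Category.assoc, IsIso.hom_inv_id]⟩
  have hpf : p ≫ i ≫ f = f := by
    rw [← Category.assoc, hpi]
    exact comp_pow_eq hg N
  have hWadm : IsAdmissibleEpi (modulesOf K F) (i ≫ f) := by
    have := hf.1
    have h1 : Epi (p ≫ i ≫ f) := by rw [hpf]; infer_instance
    refine ⟨epi_of_epi p _, fun X hX h => ?_⟩
    obtain ⟨k, hk⟩ := hf.2 X hX h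
    exact ⟨k ≫ p, by rw [Category.assoc, hpf, hk]⟩
  have hpiso : IsIso p :=
    isIso_of_epi_of_totalDim_le hUf hW p (hmin W _ (addOf_retract r hU) hWadm)
  have heinj (x : P) : Function.Injective (e.app x).hom := by
    have : Mono e := by rw [← hpi]; infer_instance
    exact injective_app e x
  refine isIso_of_bijective g fun x => ?_
  have := hUf x
  have hgx : Function.Injective (g.app x).hom := by
    obtain ⟨N', rfl⟩ := Nat.exists_eq_succ_of_ne_zero hN0
    have := heinj x
    rw [he, pow_succ] at this
    exact Function.Injective.of_comp (f := ((g.app x).hom ^ N')) this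
  exact ⟨hgx, LinearMap.injective_iff_surjective.1 hgx⟩

theorem exists_isCover {F : Set (Spread P)} (hF : ∀ x, upSpread x ∈ F) (M : PersMod K P)
    (hM : pwfd K P M) :
    ∃ (U : PersMod K P) (f : U ⟶ M), IsCover (modulesOf K F) f ∧ pwfd K P (kernel f) := by
  classical
  have h : ∃ d, ∃ (U : PersMod K P) (f : U ⟶ M), totalDim U = d ∧ addOf (modulesOf K F) U ∧
      IsAdmissibleEpi (modulesOf K F) f := by
    obtain ⟨U, f, hU, hf⟩ := exists_admissibleEpi hF hM
    exact ⟨_, U, f, rfl, hU, hf⟩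
  obtain ⟨U, f, hd, hU, hf⟩ := Nat.find_spec h
  refine ⟨U, f, isCover_of_minimal f hU hf fun W f' hW hf' => ?_,
    pwfd_of_mono (kernel.ι f) (pwfd_of_addOf hU)⟩
  rw [hd]
  exact Nat.find_min' h ⟨W, f', rfl, hW, hf'⟩

end Covers

/-! ### The lower bound for the relative global dimension. -/

section LowerBound

variable {n : ℕ} {K : Type u} [Field K] (hn : 1 < n) {F : Set (Spread (Grid n))}

lemma addOf_koszulX (hF : ∀ B, koszulSpread hn B ∈ F) (p : ℕ) :
    addOf (modulesOf K F) (koszulX K hn p) :=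
  addOf_biproduct _ fun B => modulesOf_spreadModule (hF B.1)

lemma homExactAt_koszulComplex (F : Set (Spread (Grid n))) (q : ℕ) (X : PersMod K (Grid n))
    (hX : modulesOf K F X) : HomExactAt (koszulComplex K hn) X (q + 1) := by
  obtain ⟨T, -, ⟨e⟩⟩ := hX
  refine HomExactAt.retract e.retract fun f hf => ?_
  have := hf q
  rw [koszulComplex_d] at this ⊢
  exact exists_factor_succ hn f this

/-- The kernel of the last nonzero differential of the Koszul-type complex has large dimension. -/
theorem le_relDim_kernel (hup : ∀ x, upSpread x ∈ F) (hF : ∀ B, koszulSpread hn B ∈ F) {m : ℕ}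
    (hm : n = m + 2) :
    (m : ℕ∞) ≤ relDim (modulesOf K F) (kernel ((koszulComplex K hn).d (m + 1) (m + 2))) := by
  let V := koszulComplex K hn
  have hVadd : ∀ p, addOf (modulesOf K F) (V.X p) := addOf_koszulX hn hF
  let t := coverTower (exists_isCover (K := K) hup) (kernel (V.d (m + 1) (m + 2)))
    (pwfd_of_mono (kernel.ι _) (pwfd_of_addOf (hVadd (m + 1))))
  refine le_trans (le_resolutionLength fun j hj hz => ?_)
    (le_iSup₂_of_le t.complex (t.f 0) (le_iSup_of_le t.isMinimalResolution le_rfl))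
  -- If the resolution stopped before degree `m`, dimension shifting would give exactness of Hom(V,
  -- Z) in degree `m` for the kernel `Z`.
  have h1 := t.homExactAt hVadd (homExactAt_koszulComplex hn F) hz (j + 1) le_rfl (m - (j + 1))
  rw [Nat.sub_self, show j + 1 + (m - (j + 1)) = m by omega] at h1
  change HomExactAt V (kernel (V.d (m + 1) (m + 2))) m at h1
  obtain ⟨ψ, hψ⟩ := h1 (kernel.lift (V.d (m + 1) (m + 2)) (V.d m (m + 1)) (V.d_comp_d _ _ _))
    fun p => by
      rw [← cancel_mono (kernel.ι (V.d (m + 1) (m + 2))), Category.assoc, kernel.lift_ι,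
        V.d_comp_d, zero_comp]
  have h2 : V.d m (m + 1) ≫ ψ ≫ kernel.ι (V.d (m + 1) (m + 2)) = V.d m (m + 1) := by
    rw [← Category.assoc, hψ, kernel.lift_ι]
  have h3 : HomExactAt V (V.X (m + 1)) (m + 1) :=
    HomExactAt.of_addOf (fun X hX => homExactAt_koszulComplex hn F m X hX) (hVadd (m + 1))
  -- This difference kills the incoming differential, so it factors through a morphism V^(m+2) →
  -- V^(m+1), which is zero. Hence the kernel inclusion is a split epimorphism and the differential
  -- vanishes.
  obtain ⟨χ, hχ⟩ := h3 (𝟙 _ - ψ ≫ kernel.ι (V.d (m + 1) (m + 2))) fun p => by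
    by_cases hp : p = m
    · subst hp
      rw [Preadditive.comp_sub, h2, Category.comp_id, sub_self]
    · rw [V.shape p (m + 1) (by simpa using hp), zero_comp]
  have hχ0 : χ = 0 := koszulX_hom_eq_zero hn χ
  rw [hχ0, comp_zero] at hχ
  have h4 : V.d (m + 1) (m + 2) = 0 := by
    have := congrArg (fun s => s ≫ V.d (m + 1) (m + 2)) hχ
    simpa using this.symm
  have h5 : HomExactAt V (V.X (m + 2)) (m + 2) :=
    HomExactAt.of_addOf (fun X hX => homExactAt_koszulComplex hn F (m + 1) X hX) (hVadd (m + 2))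
  -- With no incoming differential left, the identity of V^(m+2) factors through a zero morphism,
  -- although V^n is nonzero for `n = m + 2`.
  obtain ⟨g, hg⟩ := h5 (𝟙 _) fun p => by
    by_cases hp : p = m + 1
    · subst hp
      rw [h4, zero_comp]
    · rw [V.shape p (m + 2) (by simpa using hp), zero_comp]
  have hg0 : g = 0 := koszulX_hom_eq_zero hn g
  rw [hg0, comp_zero] at hg
  exact koszulX_not_isZero (K := K) hn hm.ge ((IsZero.iff_id_eq_zero _).2 hg.symm)

include hn in
theorem le_spreadGlobalDim (k : SpreadClass) :
    ((n - 2 : ℕ) : ℕ∞) ≤ spreadGlobalDim K k (Grid n) := by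
  have hF : ∀ B, koszulSpread hn B ∈ k.spreads (Grid n) := fun B =>
    k.mem_spreads_of_isSingleSource (koszulSpread_isSingleSource hn B)
  have hup : ∀ x, upSpread x ∈ k.spreads (Grid n) := fun x =>
    k.mem_spreads_of_isSingleSource (upSpread_isSingleSource x)
  obtain ⟨m, rfl⟩ := Nat.exists_eq_add_of_le' (show 2 ≤ n from hn)
  rw [Nat.add_sub_cancel]
  refine (le_relDim_kernel (K := K) hn hup hF rfl).trans ?_
  refine le_iSup₂_of_le _ ?_ le_rfl
  exact pwfd_of_mono (kernel.ι _) (pwfd_of_addOf (addOf_koszulX hn hF (m + 1)))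

end LowerBound

end SpreadRes

end

open SpreadRes
theorem mainTheorem10 {K : Type*} [Field K] (k : SpreadClass) :
    (∀ (n : ℕ) (hn : 1 < n),
      -- the spreads `S \ B'` are single-source; `G` is a generator-cogenerator of `rep P`
      (∀ B' : Finset (Fin n), (koszulSpread hn B').IsSingleSource) ∧
      (∀ Q : PersMod K (Grid n), pwfd K (Grid n) Q →
        (Projective Q ∨ Injective Q) →
        addOf (modulesOf K (k.spreads (Grid n))) Q) ∧
      -- the Koszul-type complex `U` is exact
      (∀ p : ℕ, (koszulComplex K hn).ExactAt p) ∧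
      -- the top of the `End G`-module `Hom(I_S, G)` is simple
      IsSimpleModule
        (End (sumOf K (k.spreads (Grid n))))
        (topHomModule (spreadModule K (koszulSpread hn ∅))
          (sumOf K (k.spreads (Grid n)))) ∧
      -- `Hom(U, G)` is a minimal projective resolution, of length `n`, of this simple top
      (∃ π, IsMinimalResolution (isProjective _)
        (M := topHomModule (spreadModule K (koszulSpread hn ∅))
          (sumOf K (k.spreads (Grid n))))
        (homComplex (koszulComplex K hn)
          (sumOf K (k.spreads (Grid n)))) π) ∧
      resolutionLength
        (homComplex (koszulComplex K hn)
          (sumOf K (k.spreads (Grid n)))) = n ∧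
      projectiveDimension
        (topHomModule (spreadModule K (koszulSpread hn ∅))
          (sumOf K (k.spreads (Grid n)))) = (n : ℕ) ∧
      -- the lower bound for the relative global dimension
      ((n - 2 : ℕ) : ℕ∞) ≤ spreadGlobalDim K k (Grid n)) ∧
    -- there is no uniform bound
    ¬ ∃ N : ℕ, ∀ n : ℕ, 1 < n → spreadGlobalDim K k (Grid n) ≤ (N : ℕ∞) := by
  refine ⟨fun n hn => ?_, ?_⟩
  · have hF : ∀ B, koszulSpread hn B ∈ k.spreads (Grid n) := fun B =>
      k.mem_spreads_of_isSingleSource (koszulSpread_isSingleSource hn B)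
    have hU := koszulComplex_isDualResolution (K := K) hn hF
    have hres := hU.isMinimalResolution (koszulXZeroIso hn)
    have hzero : ∀ i ≤ n, ¬ IsZero ((homComplex (koszulComplex K hn)
        (sumOf K (k.spreads (Grid n)))).X i) := fun i hi h =>
      koszulX_not_isZero hn hi ((hU.isZero_homComplex_iff i).1 h)
    have hzero' : IsZero ((homComplex (koszulComplex K hn)
        (sumOf K (k.spreads (Grid n)))).X (n + 1)) :=
      (hU.isZero_homComplex_iff (n + 1)).2 (koszulX_isZero hn n.lt_succ_self)
    refine ⟨koszulSpread_isSingleSource hn, ?_, koszulComplex_exactAt hn,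
      hU.isSimpleModule_top (koszulXZeroIso hn), ⟨_, hres⟩,
      resolutionLength_eq hzero hzero', hres.projectiveDimension_eq hn (hzero n le_rfl) hzero',
      le_spreadGlobalDim hn k⟩
    rintro Q hQ (h | h)
    · exact addOf_of_projective
        (fun x => k.mem_spreads_of_isSingleSource (upSpread_isSingleSource x)) hQ
    · exact addOf_of_injective
        (fun x => k.mem_spreads_of_isSingleSource (downSpread_isSingleSource hn x)) hQ
  · rintro ⟨N, hN⟩
    -- The grid of side `N + 3` has dimension at least `N + 1`.
    have h := (le_spreadGlobalDim (K := K) (show 1 < N + 3 by omega) k).trans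
      (hN (N + 3) (by omega))
    rw [Nat.cast_le] at h
    omega
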